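/- **Theorem 1.3.** Let $\mathrm{k}$ be a field, let $n\ge 2$, let $S=\mathrm{k}[x_1,\dots,x_n]$, and let $$J_{n,n-2}=(x_1\cdots x_{n-2},\ x_2\cdots x_{n-1},\ \dots,\ x_nx_1\cdots x_{n-3})\subseteq S$$ be the ideal generated by the $n$ products of $n-2$ cyclically consecutive variables (indices modulo $n$), with $J_{2,0}=S$. For an ideal $I$ of $S$ put $\beta_i(I)=\dim_{\mathrm{k}}\operatorname{Tor}_i^S(\mathrm{k},I)$, where $\mathrm{k}=S/(x_1,\dots,x_n)$. Binomial coefficients follow the convention $\binom{a}{b}=0$ for integers $a<b$ with $b\ge 0$ (in particular for $a<0$), and an empty sum is $0$. Let $k\ge 1$ be an integer. 1. For all $i\ge 0$, $t\ge 0$ and $n=2k+1$, the number $\beta_i(J_{n,n-2}^t)$ is finite and $$\beta_i(J_{n,n-2}^t)=\sum_{j=0}^{\lfloor i/2\rfloor}\binom{n}{i-2j}\binom{n+t-1-i+j}{n-1}-\sum_{j=0}^{\lfloor (i-1)/2\rfloor}\binom{n}{i-1-2j}\binom{t+k-1-j}{n-1}.$$ 2. For all $i\ge 0$, $t\ge 0$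 and $n=2k$, the number $\beta_i(J_{n,n-2}^t)$ is finite and $$\beta_i(J_{n,n-2}^t)=\sum_{j=0}^{\lfloor i/2\rfloor}\binom{n}{i-2j}\binom{n+t-1-i+j}{n-1}-\sum_{j=0}^{\lfloor i/2\rfloor}\binom{n}{i-2j}\binom{t+k-1-j}{n-1}.$$ -/

import Mathlib

/-- The `m`-path ideal `J_{n,m} = (x_1 ⋯ x_m, x_2 ⋯ x_{m+1}, …, x_n x_1 ⋯ x_{m-1})` of the cycle of
length `n`, in the polynomial ring over `K` in `n` variables (indexed from `0` to `n - 1`, the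
indices being read modulo `n`). For `m = 0` the generators are empty products, so the ideal is the
unit ideal. -/
noncomputable def cyclePathIdeal (K : Type*) [Field K] (n m : ℕ) :
    Ideal (MvPolynomial (Fin n) K) :=
  Ideal.span (Set.range fun a : Fin n =>
    ∏ r ∈ Finset.range m, MvPolynomial.X ⟨((a : ℕ) + r) % n, Nat.mod_lt _ a.pos⟩)

/-- The residue field `K = S ⧸ (x_1, …, x_n)` as a module over `S = K[x_1, …, x_n]`. -/
noncomputable abbrev residueModule.{u} (K : Type u) [Field K] (n : ℕ) :
    ModuleCat.{u} (MvPolynomial (Fin n) K) :=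
  ModuleCat.of (MvPolynomial (Fin n) K)
    (MvPolynomial (Fin n) K ⧸
      Ideal.span (Set.range (MvPolynomial.X : Fin n → MvPolynomial (Fin n) K)))

/-- `Tor_i^S(K, I)` for an ideal `I` of `S = K[x_1, …, x_n]`, regarded as a `K`-vector space. -/
noncomputable def torSpace.{u} {K : Type u} [Field K] {n : ℕ}
    (I : Ideal (MvPolynomial (Fin n) K)) (i : ℕ) : ModuleCat.{u} K :=
  (ModuleCat.restrictScalars (algebraMap K (MvPolynomial (Fin n) K))).obj
    (((CategoryTheory.Tor (ModuleCat.{u} (MvPolynomial (Fin n) K)) i).obj (residueModule K n)).obj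
      (ModuleCat.of (MvPolynomial (Fin n) K) I))

/-- The `i`-th Betti number `β_i(I) = dim_K Tor_i^S(K, I)` of an ideal `I`. -/
noncomputable def bettiNumber.{u} {K : Type u} [Field K] {n : ℕ}
    (I : Ideal (MvPolynomial (Fin n) K)) (i : ℕ) : ℕ :=
  Module.finrank K (torSpace I i)

/-- The binomial coefficient `a` over `b` with the convention that it is `0` whenever `a < b`,
in particular whenever the upper entry `a` is negative. -/
def binom (a : ℤ) (b : ℕ) : ℤ := if 0 ≤ a then (a.toNat.choose b : ℤ) else 0

/-! Each generator omits the two ends of an edge of the `n`-cycle, so a product of `t` generators is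
an edge weight `w` of sum `t`, and the exponent of `x_v` is `t` minus the degree of `w` at `v`. List
these products by increasing lexicographic order of `w`. If `n` is odd, every weight counts. If `n`
is even, a weight that is positive on all even positions repeats the monomial of an earlier one, so
only the remaining, standard weights count. At a standard weight the colon ideal of the earlier
products is generated by `r(w)` variables (`exists_isColonVariable_of_lex_lt`,
`exists_lex_lt_of_isColonVariable`). Thus the power has linear quotients and a linear, hence
minimal, resolution; tensoring it with the residue field gives `β_i = ∑ choose (r(w)) i` over
standard `w`.

The generating function `∑ (1 + z)^r(w) u^|w|` factors over positions once the weights are sorted by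
their first vanishing even position. Summing over that position telescopes. With `n = 2k` or `n = 2k
+ 1`, multiplying by `(1 - z²u)(1 - u)^n` leaves `(1 + zu)^n - (1 + z)^n u^k` for even `n`, and `(1
+ zu)^n - z(1 + z)^n u^(k+1)` for odd `n`. The coefficients of `z^i u^t` are the two formulas. -/

/-! ### Linear resolutions and linear quotients. -/

section LinearResolution

open MvPolynomial

variable {K : Type*} [Field K] {σ : Type*}

theorem homogeneousComponent_mul_of_isHomogeneous {d : ℕ} {g : MvPolynomial σ K}
    (hg : g.IsHomogeneous d) (f : MvPolynomial σ K) (e : ℕ) :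
    homogeneousComponent (e + d) (f * g) = homogeneousComponent e f * g := by
  conv_lhs => rw [← sum_homogeneousComponent f, Finset.sum_mul, map_sum]
  have h : ∀ i ∈ Finset.range (f.totalDegree + 1),
      homogeneousComponent (e + d) (homogeneousComponent i f * g) =
        if e = i then homogeneousComponent i f * g else 0 := fun i _ => by
    rw [homogeneousComponent_of_mem ((mem_homogeneousSubmodule _ _).2
      ((homogeneousComponent_isHomogeneous i f).mul hg))]
    simp
  rw [Finset.sum_congr rfl h, Finset.sum_ite_eq]
  split_ifs with he
  · rfl
  · rw [homogeneousComponent_eq_zero _ _ (by simpa using he), zero_mul]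

/-- The syzygies of a finite family of vectors. -/
noncomputable def syzygies {ι κ : Type} [Fintype κ] (g : κ → ι → MvPolynomial σ K) :
    Submodule (MvPolynomial σ K) (κ → MvPolynomial σ K) :=
  LinearMap.ker (Fintype.linearCombination (MvPolynomial σ K) g)

theorem mem_syzygies {ι κ : Type} [Fintype κ] {g : κ → ι → MvPolynomial σ K}
    {u : κ → MvPolynomial σ K} : u ∈ syzygies g ↔ ∑ j, u j • g j = 0 := by
  simp [syzygies, Fintype.linearCombination_apply]

/-- A submodule of a free module that is closed under taking homogeneous components, all basis
vectors being in the same degree. -/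
def IsHomogeneousSub {ι : Type} (N : Submodule (MvPolynomial σ K) (ι → MvPolynomial σ K)) : Prop :=
  ∀ v ∈ N, ∀ e, (fun j => homogeneousComponent e (v j)) ∈ N

/-- `LinearRes p N d b`: the submodule `N` has a linear free resolution of length less than `p` with
generators in degree `d` and with Betti numbers `b`. -/
def LinearRes : ℕ → ∀ {ι : Type},
    Submodule (MvPolynomial σ K) (ι → MvPolynomial σ K) → ℕ → (ℕ → ℕ) → Prop
  | 0, _, N, _, b => N = ⊥ ∧ b = 0
  | p + 1, ι, N, d, b => ∃ (κ : Type) (_ : Fintype κ) (g : κ → ι → MvPolynomial σ K),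
      (∀ j l, (g j l).IsHomogeneous d) ∧ Submodule.span _ (Set.range g) = N ∧
      Fintype.card κ = b 0 ∧ LinearRes p (syzygies g) 1 (fun i => b (i + 1))

/-- This lets the horseshoe argument be repeated on syzygies: its hypothesis on the middle term is
inherited at each step. -/
theorem isHomogeneousSub_syzygies {ι κ : Type} [Fintype κ] {g : κ → ι → MvPolynomial σ K} {d : ℕ}
    (hg : ∀ j l, (g j l).IsHomogeneous d) : IsHomogeneousSub (syzygies g) := by
  intro u hu e
  rw [mem_syzygies] at hu ⊢
  ext1 l
  have h := congrArg (homogeneousComponent (e + d)) (congrFun hu l)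
  simp only [Finset.sum_apply, Pi.smul_apply, smul_eq_mul, map_sum, Pi.zero_apply, map_zero] at h ⊢
  rw [← h]
  exact Finset.sum_congr rfl fun j _ => (homogeneousComponent_mul_of_isHomogeneous (hg j l) _ e).symm

theorem LinearRes.succ {p : ℕ} : ∀ {ι : Type}
    {N : Submodule (MvPolynomial σ K) (ι → MvPolynomial σ K)} {d : ℕ} {b : ℕ → ℕ},
    LinearRes p N d b → LinearRes (p + 1) N d b := by
  induction p with
  | zero =>
    rintro ι N d b ⟨rfl, rfl⟩
    exact ⟨Empty, inferInstance, Empty.elim, fun j => j.elim, by simp, by simp,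
      Subsingleton.elim _ _, rfl⟩
  | succ p ih =>
    rintro ι N d b ⟨κ, _, g, h1, h2, h3, h4⟩
    exact ⟨κ, _, g, h1, h2, h3, ih h4⟩

theorem LinearRes.mono {p q : ℕ} (hpq : p ≤ q) {ι : Type}
    {N : Submodule (MvPolynomial σ K) (ι → MvPolynomial σ K)} {d : ℕ} {b : ℕ → ℕ}
    (h : LinearRes p N d b) : LinearRes q N d b := by
  induction q, hpq using Nat.le_induction with
  | base => exact h
  | succ q _ ih => exact ih.succ

theorem mem_span_range_iff_sum_smul {ι κ : Type} [Fintype κ] {g : κ → ι → MvPolynomial σ K}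
    {v : ι → MvPolynomial σ K} :
    v ∈ Submodule.span (MvPolynomial σ K) (Set.range g) ↔ ∃ s : κ → MvPolynomial σ K,
      ∑ j, s j • g j = v := by
  rw [← Fintype.range_linearCombination]
  rfl

/-- The horseshoe lemma for linear resolutions. -/
theorem LinearRes.extension {p : ℕ} : ∀ {α γ : Type}
    {A : Submodule (MvPolynomial σ K) (α → MvPolynomial σ K)}
    {C : Submodule (MvPolynomial σ K) (γ → MvPolynomial σ K)}
    {B : Submodule (MvPolynomial σ K) (α ⊕ γ → MvPolynomial σ K)} {d : ℕ} {a c : ℕ → ℕ},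
    LinearRes p A d a → LinearRes p C d c → IsHomogeneousSub B →
    (∀ v, Sum.elim v (0 : γ → MvPolynomial σ K) ∈ B ↔ v ∈ A) → (∀ w, w ∈ C ↔ ∃ v, Sum.elim v w ∈ B) →
    LinearRes p B d (a + c) := by
  induction p with
  | zero =>
    rintro α γ A C B d a c ⟨rfl, rfl⟩ ⟨rfl, rfl⟩ - hA hC
    refine ⟨?_, by simp⟩
    rw [eq_bot_iff]
    intro v hv
    rw [← Sum.elim_comp_inl_inr v] at hv ⊢
    have h0 := (hC _).2 ⟨_, hv⟩
    rw [Submodule.mem_bot] at h0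
    rw [h0, hA, Submodule.mem_bot] at hv
    rw [hv, h0]
    simp
  | succ p ih =>
    rintro α γ A C B d a c ⟨κ, _, g, g1, rfl, g3, g4⟩ ⟨μ, _, h, h1, rfl, h3, h4⟩ hB hA hC
    have hlift : ∀ j : μ, ∃ v : α → MvPolynomial σ K, (∀ l, (v l).IsHomogeneous d) ∧
        Sum.elim v (h j) ∈ B := by
      intro j
      obtain ⟨v, hv⟩ := (hC (h j)).1 (Submodule.subset_span ⟨j, rfl⟩)
      -- Cutting an arbitrary lift down to degree `d` does not change its image `h j`, which already
      -- lives in degree `d`. This keeps the combined resolution linear.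
      refine ⟨fun l => homogeneousComponent d (v l),
        fun l => homogeneousComponent_isHomogeneous d _, ?_⟩
      convert hB _ hv d using 1
      ext1 x
      cases x with
      | inl x => rfl
      | inr x => simp [homogeneousComponent_of_mem ((mem_homogeneousSubmodule d _).2 (h1 j x))]
    choose w hw1 hw2 using hlift
    let G : κ ⊕ μ → α ⊕ γ → MvPolynomial σ K :=
      Sum.elim (fun j => Sum.elim (g j) 0) (fun j => Sum.elim (w j) (h j))
    have hGB : ∀ j, G j ∈ B := by
      rintro (j | j)
      · exact (hA _).2 (Submodule.subset_span ⟨j, rfl⟩)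
      · exact hw2 j
    have hG : ∀ j l, (G j l).IsHomogeneous d := by
      rintro (j | j) (l | l)
      · exact g1 j l
      · exact isHomogeneous_zero _ _ _
      · exact hw1 j l
      · exact h1 j l
    have hsum : ∀ (s : κ → MvPolynomial σ K) (r : μ → MvPolynomial σ K),
        ∑ j, Sum.elim s r j • G j =
          Sum.elim (∑ j, s j • g j + ∑ j, r j • w j) (∑ j, r j • h j) := by
      intro s r
      ext1 x
      cases x <;> simp [G, Fintype.sum_sum_type]
    -- a combination of lifts that vanishes in `C` comes from `A`
    have hred : ∀ (v : α → MvPolynomial σ K) (r : μ → MvPolynomial σ K),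
        Sum.elim v (∑ j, r j • h j) ∈ B → ∃ s : κ → MvPolynomial σ K,
          ∑ j, s j • g j + ∑ j, r j • w j = v := by
      intro v r hv
      have h2 : ∑ j, r j • G (Sum.inr j) ∈ B :=
        Submodule.sum_mem _ fun j _ => Submodule.smul_mem _ _ (hGB _)
      have h3 := Submodule.sub_mem _ hv h2
      have h4 : Sum.elim v (∑ j, r j • h j) - ∑ j, r j • G (Sum.inr j) =
          Sum.elim (v - ∑ j, r j • w j) 0 := by
        ext1 x
        cases x <;> simp [G]
      rw [h4, hA] at h3
      obtain ⟨s, hs⟩ := mem_span_range_iff_sum_smul.1 h3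
      exact ⟨s, by rw [hs]; abel⟩
    refine ⟨κ ⊕ μ, inferInstance, G, hG, ?_, by simp [g3, h3], ?_⟩
    · apply le_antisymm
      · rw [Submodule.span_le]
        rintro _ ⟨j, rfl⟩
        exact hGB j
      · intro v hv
        rw [← Sum.elim_comp_inl_inr v] at hv ⊢
        obtain ⟨r, hr⟩ := mem_span_range_iff_sum_smul.1 ((hC _).2 ⟨_, hv⟩)
        rw [← hr] at hv ⊢
        obtain ⟨s, hs⟩ := hred _ _ hv
        exact mem_span_range_iff_sum_smul.2 ⟨Sum.elim s r, by rw [hsum, hs]⟩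
    · refine ih g4 h4 (isHomogeneousSub_syzygies hG) ?_ ?_
      · intro s
        rw [mem_syzygies, mem_syzygies, hsum s 0]
        constructor
        · intro h0
          ext1 x
          simpa using congrFun h0 (Sum.inl x)
        · intro h0
          rw [h0]
          simp
      · intro r
        rw [mem_syzygies]
        constructor
        · intro h0
          obtain ⟨s, hs⟩ := hred 0 r (by rw [h0]; simp)
          exact ⟨s, by rw [mem_syzygies, hsum, hs, h0]; simp⟩
        · rintro ⟨s, hs⟩
          rw [mem_syzygies, hsum] at hs
          ext1 x
          simpa using congrFun hs (Sum.inr x)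

/-- The ideal `I` as a submodule of the free module of rank one. -/
noncomputable def idealSub (I : Ideal (MvPolynomial σ K)) :
    Submodule (MvPolynomial σ K) (Unit → MvPolynomial σ K) :=
  Submodule.comap (LinearMap.proj () : (Unit → MvPolynomial σ K) →ₗ[MvPolynomial σ K] _) I

theorem mem_idealSub {I : Ideal (MvPolynomial σ K)} {v : Unit → MvPolynomial σ K} :
    v ∈ idealSub I ↔ v () ∈ I := Iff.rfl

/-- Adding a generator whose colon ideal has a linear resolution. -/
theorem LinearRes.sup_span {p d : ℕ} {I C : Ideal (MvPolynomial σ K)} {h : MvPolynomial σ K}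
    (hh : h.IsHomogeneous d) {b c : ℕ → ℕ} (hI : LinearRes (p + 1) (idealSub I) d b)
    (hC : LinearRes p (idealSub C) 1 (fun i => c (i + 1))) (hc : c 0 = 1)
    (hcolon : ∀ f, f ∈ C ↔ f * h ∈ I) :
    LinearRes (p + 1) (idealSub (I ⊔ Ideal.span {h})) d (b + c) := by
  obtain ⟨κ, _, g, g1, g2, g3, g4⟩ := hI
  let G : κ ⊕ Unit → Unit → MvPolynomial σ K := Sum.elim g (fun _ _ => h)
  have hG : ∀ j l, (G j l).IsHomogeneous d := by
    rintro (j | j) l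
    · exact g1 j l
    · exact hh
  have hsum : ∀ (s : κ → MvPolynomial σ K) (r : Unit → MvPolynomial σ K),
        ∑ j, Sum.elim s r j • G j = ∑ j, s j • g j + (fun _ => r () * h) := by
    intro s r
    ext1 x
    simp [G, Fintype.sum_sum_type]
  have hmem : ∀ v, v ∈ idealSub I ↔ ∃ s : κ → MvPolynomial σ K, ∑ j, s j • g j = v := by
    intro v
    rw [← g2, mem_span_range_iff_sum_smul]
  refine ⟨κ ⊕ Unit, inferInstance, G, hG, ?_, by simp [g3, hc], ?_⟩
  · ext v
    rw [mem_span_range_iff_sum_smul, mem_idealSub, Submodule.mem_sup]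
    constructor
    · rintro ⟨s, rfl⟩
      rw [← Sum.elim_comp_inl_inr s, hsum]
      exact ⟨_, mem_idealSub.1 ((hmem _).2 ⟨_, rfl⟩), _, Ideal.mem_span_singleton'.2 ⟨_, rfl⟩, rfl⟩
    · rintro ⟨y, hy, z, hz, hyz⟩
      obtain ⟨r, rfl⟩ := Ideal.mem_span_singleton'.1 hz
      obtain ⟨s, hs⟩ := (hmem (fun _ => y)).1 (mem_idealSub.2 hy)
      exact ⟨Sum.elim s (fun _ => r), by rw [hsum, hs]; ext1 x; exact hyz⟩
  -- Take the coefficient of `h` in a syzygy of `G`: the kernel is the syzygies of `g` and the image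
  -- is the colon ideal `C`.
  · refine LinearRes.extension g4 hC (isHomogeneousSub_syzygies hG) ?_ ?_
    · intro s
      rw [mem_syzygies, mem_syzygies, hsum s 0]
      have : (fun _ : Unit => (0 : Unit → MvPolynomial σ K) () * h) = 0 := by ext1; simp
      rw [this, add_zero]
    · intro r
      rw [mem_idealSub, hcolon]
      constructor
      · intro hr
        obtain ⟨s, hs⟩ := (hmem (fun _ => - (r () * h))).1 (mem_idealSub.2 (I.neg_mem hr))
        exact ⟨s, by rw [mem_syzygies, hsum, hs]; ext1; simp⟩
      · rintro ⟨s, hs⟩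
        rw [mem_syzygies, hsum] at hs
        have h1 : (fun _ : Unit => -(r () * h)) ∈ idealSub I :=
          (hmem _).2 ⟨s, by rw [eq_neg_of_add_eq_zero_left hs]; rfl⟩
        exact (Submodule.neg_mem_iff _).1 (mem_idealSub.1 h1)

theorem idealSub_bot : idealSub (⊥ : Ideal (MvPolynomial σ K)) = ⊥ := by
  ext v
  rw [mem_idealSub, Submodule.mem_bot, Submodule.mem_bot]
  exact ⟨fun h => funext fun _ => h, fun h => congrFun h ()⟩

/-- The ideal generated by a set of variables has a linear resolution. -/
theorem linearRes_span_X (R : Finset σ) :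
    LinearRes R.card (idealSub (Ideal.span ((X : σ → MvPolynomial σ K) '' R))) 1
      (fun i => R.card.choose (i + 1)) := by
  classical
  induction R using Finset.induction_on with
  | empty => exact ⟨by simp [idealSub_bot], by ext; simp⟩
  | insert v R hv ih =>
    rw [Finset.card_insert_of_notMem hv, Finset.coe_insert, Set.image_insert_eq, Set.insert_eq,
      Ideal.span_union, sup_comm]
    convert LinearRes.sup_span (c := fun i => R.card.choose i) (isHomogeneous_X K v) ih.succ ih
      (Nat.choose_zero_right _) ?_ using 1
    · ext i
      rw [Pi.add_apply, Nat.choose_succ_succ, add_comm]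
    · intro f
      rw [mem_ideal_span_X_image, mem_ideal_span_X_image]
      constructor
      · intro h m hm
        rw [support_mul_X, Finset.mem_map] at hm
        obtain ⟨m', hm', rfl⟩ := hm
        obtain ⟨i, hi, hi'⟩ := h m' hm'
        exact ⟨i, hi, by simp [hi']⟩
      · intro h m hm
        obtain ⟨i, hi, hi'⟩ := h (m + Finsupp.single v 1) (by
          rw [support_mul_X, Finset.mem_map]
          exact ⟨m, hm, rfl⟩)
        refine ⟨i, hi, ?_⟩
        have : v ≠ i := by rintro rfl; exact hv hi
        simpa [Finsupp.single_apply, this] using hi'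

/-- An ideal with linear quotients has a linear resolution; generators that lie in the ideal of
their predecessors do not count. -/
theorem linearRes_of_linearQuotients {α : Type*} [LinearOrder α] {d : ℕ} (T : Finset α)
    (g : α → MvPolynomial σ K) (hg : ∀ w ∈ T, (g w).IsHomogeneous d)
    (std : α → Prop) [DecidablePred std] (R : α → Finset σ)
    (hstd : ∀ w ∈ T, std w → ∀ f, f ∈ Ideal.span ((X : σ → MvPolynomial σ K) '' R w) ↔
      f * g w ∈ Ideal.span (g '' {w' | w' ∈ T ∧ w' < w}))
    (hnstd : ∀ w ∈ T, ¬ std w → g w ∈ Ideal.span (g '' {w' | w' ∈ T ∧ w' < w})) :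
    ∃ p, LinearRes p (idealSub (Ideal.span (g '' T))) d
      (fun i => ∑ w ∈ T with std w, (R w).card.choose i) := by
  induction T using Finset.induction_on_max with
  | empty => exact ⟨0, by simp [idealSub_bot], by ext; simp⟩
  | insert a s hs ih =>
    have ha : a ∉ s := fun h => lt_irrefl _ (hs a h)
    have hset : ∀ w ∈ s, {w' | w' ∈ insert a s ∧ w' < w} = {w' | w' ∈ s ∧ w' < w} := by
      intro w hw
      ext w'
      simp only [Finset.mem_insert, Set.mem_ofPred_eq]
      constructor
      · rintro ⟨rfl | h, h'⟩
        · exact absurd h' (not_lt.2 (hs w hw).le)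
        · exact ⟨h, h'⟩
      · rintro ⟨h, h'⟩
        exact ⟨Or.inr h, h'⟩
    have hset' : {w' | w' ∈ insert a s ∧ w' < a} = (s : Set α) := by
      ext w'
      simp only [Finset.mem_insert, Set.mem_ofPred_eq, Finset.mem_coe]
      constructor
      · rintro ⟨rfl | h, h'⟩
        · exact absurd h' (lt_irrefl _)
        · exact h
      · intro h
        exact ⟨Or.inr h, hs _ h⟩
    obtain ⟨p, hp⟩ := ih (fun w hw => hg w (Finset.mem_insert_of_mem hw))
      (fun w hw => hset w hw ▸ hstd w (Finset.mem_insert_of_mem hw))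
      (fun w hw => hset w hw ▸ hnstd w (Finset.mem_insert_of_mem hw))
    have hspan : Ideal.span (g '' ↑(insert a s)) = Ideal.span (g '' s) ⊔ Ideal.span {g a} := by
      rw [Finset.coe_insert, Set.image_insert_eq, Set.insert_eq, Ideal.span_union, sup_comm]
    rw [hspan]
    by_cases h : std a
    · have hc := hstd a (Finset.mem_insert_self a s) h
      rw [hset'] at hc
      refine ⟨max p (R a).card + 1, ?_⟩
      convert LinearRes.sup_span (c := fun i => (R a).card.choose i)
        (hg a (Finset.mem_insert_self a s)) (hp.mono (le_max_left p (R a).card)).succ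
        ((linearRes_span_X (R a)).mono (le_max_right p _)) (Nat.choose_zero_right _) hc using 1
      ext i
      rw [Finset.filter_insert, if_pos h, Finset.sum_insert (by simp [ha]), add_comm]
      rfl
    · have hc := hnstd a (Finset.mem_insert_self a s) h
      rw [hset'] at hc
      refine ⟨p, ?_⟩
      rw [sup_eq_left.2 ((Ideal.span_singleton_le_iff_mem _).2 hc)]
      simpa only [Finset.filter_insert, if_neg h] using hp

end LinearResolution

/-! ### Minimality of linear resolutions and the residue field. -/

section Resolution

open MvPolynomial

variable {K : Type*} [Field K] {σ : Type*}

theorem isHomogeneous_one_mem_span_X {f : MvPolynomial σ K} (hf : f.IsHomogeneous 1) :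
    f ∈ Ideal.span (Set.range (X : σ → MvPolynomial σ K)) := by
  rw [← Set.image_univ, mem_ideal_span_X_image]
  intro m hm
  by_contra! h
  have h0 : m = 0 := Finsupp.ext fun i => h i (Set.mem_univ i)
  have := hf (mem_support_iff.1 hm)
  simp [h0] at this

/-- A linear resolution, spelled out as an exact sequence of free modules whose differentials have
entries in the ideal of the variables. -/
theorem LinearRes.exists_resolution {p : ℕ} : ∀ {ι : Type}
    {N : Submodule (MvPolynomial σ K) (ι → MvPolynomial σ K)} {d : ℕ} {b : ℕ → ℕ},
    LinearRes p N d b → ∃ (κ : ℕ → Type) (_ : ∀ i, Fintype (κ i))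
      (ε : (κ 0 → MvPolynomial σ K) →ₗ[MvPolynomial σ K] (ι → MvPolynomial σ K))
      (D : ∀ i, (κ (i + 1) → MvPolynomial σ K) →ₗ[MvPolynomial σ K] (κ i → MvPolynomial σ K)),
      (∀ i, Fintype.card (κ i) = b i) ∧ LinearMap.range ε = N ∧
      LinearMap.range (D 0) = LinearMap.ker ε ∧
      (∀ i, LinearMap.range (D (i + 1)) = LinearMap.ker (D i)) ∧
      (d = 1 → ∀ v l, ε v l ∈ Ideal.span (Set.range (X : σ → MvPolynomial σ K))) ∧
      ∀ i v l, D i v l ∈ Ideal.span (Set.range (X : σ → MvPolynomial σ K)) := by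
  induction p with
  | zero =>
    rintro ι N d b ⟨rfl, rfl⟩
    exact ⟨fun _ => Empty, fun _ => inferInstance, 0, fun _ => 0, by simp, by simp,
      Subsingleton.elim _ _, fun _ => Subsingleton.elim _ _, by simp, by simp⟩
  | succ p ih =>
    rintro ι N d b ⟨κ, _, g, hg, rfl, h3, h4⟩
    obtain ⟨κ', _, ε', D', c1, c2, c3, c4, c5, c6⟩ := ih h4
    refine ⟨fun i => Nat.casesOn i κ κ', fun i => by cases i <;> dsimp only <;> infer_instance,
      Fintype.linearCombination _ g, fun i => match i with
        | 0 => ε'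
        | i + 1 => D' i, ?_, Fintype.range_linearCombination _ g, c2, ?_, ?_, ?_⟩
    · rintro (_ | i)
      · exact h3
      · exact c1 i
    · rintro (_ | i)
      · exact c3
      · exact c4 i
    -- Only `d = 1` makes the augmentation minimal. Syzygies always satisfy it, and there the
    -- augmentation becomes the first differential one level up.
    · rintro rfl v l
      rw [Fintype.linearCombination_apply, Finset.sum_apply]
      exact Ideal.sum_mem _ fun j _ =>
        Ideal.mul_mem_left _ _ (isHomogeneous_one_mem_span_X (hg j l))
    · rintro (_ | i)
      · exact c5 rfl
      · exact c6 i

theorem span_X_eq_ker :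
    Ideal.span (Set.range (X : σ → MvPolynomial σ K)) =
      RingHom.ker (aeval (0 : σ → K) : MvPolynomial σ K →ₐ[K] K) := by
  ext f
  rw [← Set.image_univ, mem_ideal_span_X_image, RingHom.mem_ker]
  have h : aeval (0 : σ → K) f = coeff 0 f := by
    rw [← constantCoeff_eq]
    exact congrArg (fun φ : MvPolynomial σ K →+* K => φ f) (by
      ext <;> simp : (aeval (0 : σ → K) : MvPolynomial σ K →ₐ[K] K).toRingHom = constantCoeff)
  rw [h]
  constructor
  · intro hf
    by_contra h0
    obtain ⟨i, -, hi⟩ := hf 0 (mem_support_iff.2 h0)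
    exact hi rfl
  · intro h0 m hm
    by_contra! h1
    have : m = 0 := Finsupp.ext fun i => h1 i (Set.mem_univ i)
    subst this
    exact mem_support_iff.1 hm h0

/-- The residue field is one-dimensional. -/
noncomputable def quotientSpanXEquiv :
    (MvPolynomial σ K ⧸ Ideal.span (Set.range (X : σ → MvPolynomial σ K))) ≃ₐ[K] K :=
  (Ideal.quotientEquivAlgOfEq K span_X_eq_ker).trans
    (Ideal.quotientKerAlgEquivOfSurjective fun c => ⟨C c, by simp⟩)

end Resolution

/-! ### Betti numbers from a minimal resolution. -/

section Tor

open CategoryTheory MonoidalCategory MvPolynomial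

universe u

/-- A projective resolution of modules from an exact sequence of projective modules. -/
noncomputable def projectiveResolutionOfExact {R : Type u} [CommRing R] {M : Type u}
    [AddCommGroup M] [Module R M] (F : ℕ → ModuleCat.{u} R) [∀ i, Module.Projective R (F i)]
    (ε : F 0 ⟶ ModuleCat.of R M) (D : ∀ i, F (i + 1) ⟶ F i)
    (hε : Function.Surjective ε) (h0 : LinearMap.range (D 0).hom = LinearMap.ker ε.hom)
    (hD : ∀ i, LinearMap.range (D (i + 1)).hom = LinearMap.ker (D i).hom) :
    ProjectiveResolution (ModuleCat.of R M) where
  complex := ChainComplex.of F D fun i => by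
    ext1
    rw [ModuleCat.hom_comp]
    exact LinearMap.range_le_ker_iff.1 (hD i).le
  projective i := (IsProjective.iff_projective (R := R) (F i)).1 inferInstance
  π := (ChainComplex.toSingle₀Equiv _ _).symm ⟨ε, by
    refine (congrArg (· ≫ ε) (ChainComplex.of_d F D 0)).trans ?_
    ext1
    rw [ModuleCat.hom_comp]
    exact LinearMap.range_le_ker_iff.1 h0.le⟩
  quasiIso := ⟨fun n => by
    cases n with
    | zero =>
      rw [ChainComplex.quasiIsoAt₀_iff, ShortComplex.quasiIso_iff_of_zeros']
      · have w : D 0 ≫ ε = 0 := by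
          ext1
          rw [ModuleCat.hom_comp]
          exact LinearMap.range_le_ker_iff.1 h0.le
        refine (ShortComplex.exact_and_epi_g_iff_of_iso (S₂ := ShortComplex.mk (D 0) ε w) ?_).2
          ⟨(ShortComplex.moduleCat_exact_iff_range_eq_ker _).2 h0,
            (ModuleCat.epi_iff_surjective _).2 hε⟩
        refine ShortComplex.isoMk (Iso.refl _) (Iso.refl _) (Iso.refl _) ?_ ?_
        · simpa using! (ChainComplex.of_d F D 0).symm
        · refine (Category.id_comp ε).trans (Eq.trans ?_ (Category.comp_id _).symm)
          exact (ChainComplex.toSingle₀Equiv_symm_apply_f_zero (C := ChainComplex.of F D _) ε _).symm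
      all_goals rfl
    | succ n =>
      rw [quasiIsoAt_iff_exactAt']
      · rw [HomologicalComplex.exactAt_iff' _ (n + 1 + 1) (n + 1) n (by simp) (by simp),
          ShortComplex.moduleCat_exact_iff_range_eq_ker]
        have h1 := congrArg (fun φ => LinearMap.range φ.hom) (ChainComplex.of_d F D (n + 1))
        have h2 := congrArg (fun φ => LinearMap.ker φ.hom) (ChainComplex.of_d F D n)
        exact h1.trans ((hD n).trans h2.symm)
      · apply ChainComplex.exactAt_succ_single_obj⟩

/-- A complex with vanishing differentials is its own homology. -/
noncomputable def homologyIsoOfDEqZero {R : Type u} [CommRing R] (C : ChainComplex (ModuleCat.{u} R) ℕ)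
    (h : ∀ i j, C.d i j = 0) (i : ℕ) : C.homology i ≅ C.X i :=
  (C.isoHomologyπ _ i rfl (h _ _)).symm ≪≫ C.iCyclesIso i _ rfl (h _ _)

/-- This is why minimality matters: a differential with entries in the ideal of the variables
vanishes after tensoring with the residue field, so Tor is the tensored complex itself. -/
theorem tmul_eq_zero_of_mem {R : Type*} [CommRing R] (m : Ideal R) {κ : Type*} [Fintype κ]
    (x : R ⧸ m) {v : κ → R} (hv : ∀ l, v l ∈ m) : x ⊗ₜ[R] v = 0 := by
  classical
  apply (TensorProduct.piScalarRight R R (R ⧸ m) κ).injective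
  ext1 l
  rw [map_zero, Pi.zero_apply, TensorProduct.piScalarRight_apply,
    TensorProduct.piScalarRightHom_tmul]
  obtain ⟨x, rfl⟩ := Ideal.Quotient.mk_surjective x
  change v l • Ideal.Quotient.mk m x = 0
  rw [← Ideal.Quotient.mk_eq_mk, ← Submodule.Quotient.mk_smul, Submodule.Quotient.mk_eq_zero]
  exact Ideal.mul_mem_right _ _ (hv l)

/-- The Betti numbers of an ideal are the ranks in a minimal free resolution. -/
theorem torSpace_of_resolution {K : Type u} [Field K] {n : ℕ} (I : Ideal (MvPolynomial (Fin n) K))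
    (κ : ℕ → Type) [∀ i, Fintype (κ i)]
    (ε : (κ 0 → MvPolynomial (Fin n) K) →ₗ[MvPolynomial (Fin n) K] I)
    (D : ∀ i, (κ (i + 1) → MvPolynomial (Fin n) K) →ₗ[MvPolynomial (Fin n) K]
      (κ i → MvPolynomial (Fin n) K))
    (hε : Function.Surjective ε) (h0 : LinearMap.range (D 0) = LinearMap.ker ε)
    (hD : ∀ i, LinearMap.range (D (i + 1)) = LinearMap.ker (D i))
    (hmin : ∀ i v l, D i v l ∈ Ideal.span (Set.range (X : Fin n → MvPolynomial (Fin n) K)))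
    (i : ℕ) :
    Module.Finite K (torSpace I i) ∧ bettiNumber I i = Fintype.card (κ i) := by
  classical
  let F : ℕ → ModuleCat.{u} (MvPolynomial (Fin n) K) :=
    fun i => ModuleCat.of _ (κ i → MvPolynomial (Fin n) K)
  have : ∀ i, Module.Projective (MvPolynomial (Fin n) K) (F i) := fun i => by
    dsimp only [F]; infer_instance
  let P := projectiveResolutionOfExact F (ModuleCat.ofHom ε) (fun i => ModuleCat.ofHom (D i)) hε h0 hD
  let T := (tensoringLeft (ModuleCat.{u} (MvPolynomial (Fin n) K))).obj (residueModule K n)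
  have hzero : ∀ i j, ((T.mapHomologicalComplex _).obj P.complex).d i j = 0 := by
    intro i j
    by_cases hij : i = j + 1
    · subst hij
      refine (congrArg T.map (ChainComplex.of_d F (fun i => ModuleCat.ofHom (D i)) j)).trans ?_
      apply ModuleCat.hom_ext
      apply TensorProduct.ext'
      intro x v
      exact tmul_eq_zero_of_mem _ x (hmin j v)
    · exact HomologicalComplex.shape _ _ _ fun h => hij h.symm
  let e₁ := (P.isoLeftDerivedObj T i) ≪≫ homologyIsoOfDEqZero _ hzero i
  let e₂ : T.obj (F i) ≅ ModuleCat.of (MvPolynomial (Fin n) K) (κ i → residueModule K n) :=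
    (TensorProduct.piScalarRight (MvPolynomial (Fin n) K) (MvPolynomial (Fin n) K)
      (residueModule K n) (κ i)).toModuleIso
  let e₃ := ((ModuleCat.restrictScalars (algebraMap K (MvPolynomial (Fin n) K))).mapIso
    (e₁ ≪≫ e₂)).toLinearEquiv
  let e₄ : (ModuleCat.restrictScalars (algebraMap K (MvPolynomial (Fin n) K))).obj
      (ModuleCat.of (MvPolynomial (Fin n) K) (κ i → residueModule K n)) ≃ₗ[K] (κ i → K) :=
    { toFun := fun v l => quotientSpanXEquiv (v l)
      invFun := fun v l => quotientSpanXEquiv.symm (v l)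
      left_inv := fun v => funext fun l => quotientSpanXEquiv.symm_apply_apply (v l)
      right_inv := fun v => funext fun l => quotientSpanXEquiv.apply_symm_apply (v l)
      map_add' := fun v w => by ext1 l; exact map_add quotientSpanXEquiv (v l) (w l)
      map_smul' := fun c v => by
        ext1 l
        refine Eq.trans ?_ (map_smul quotientSpanXEquiv c (v l))
        exact congrArg quotientSpanXEquiv (algebraMap_smul (MvPolynomial (Fin n) K) c (v l)) }
  let e : torSpace I i ≃ₗ[K] (κ i → K) := e₃.trans e₄
  exact ⟨Module.Finite.equiv e.symm, by
    rw [bettiNumber, e.finrank_eq, Module.finrank_fintype_fun_eq_card]⟩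

theorem LinearRes.torSpace {K : Type u} [Field K] {n : ℕ} {I : Ideal (MvPolynomial (Fin n) K)}
    {p d : ℕ} {b : ℕ → ℕ} (h : LinearRes p (idealSub I) d b) (i : ℕ) :
    Module.Finite K (torSpace I i) ∧ bettiNumber I i = b i := by
  obtain ⟨κ, _, ε, D, c1, c2, c3, c4, -, c6⟩ := h.exists_resolution
  have hmem : ∀ v, ε v () ∈ I := fun v => mem_idealSub.1 (c2 ▸ LinearMap.mem_range_self ε v)
  rw [← c1]
  refine torSpace_of_resolution I κ
    (LinearMap.codRestrict I ((LinearMap.proj ()).comp ε) hmem) D ?_ ?_ c4 c6 i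
  · rintro ⟨f, hf⟩
    have h1 : (fun _ : Unit => f) ∈ idealSub I := hf
    rw [← c2] at h1
    obtain ⟨v, hv⟩ := h1
    exact ⟨v, Subtype.ext (congrFun hv ())⟩
  · rw [c3]
    ext v
    rw [LinearMap.mem_ker, LinearMap.mem_ker, ← Subtype.coe_inj]
    exact ⟨fun h => congrFun h (), fun h => funext fun _ => h⟩

end Tor

/-! ### Combinatorics of edge weights on the cycle. -/

section EdgeWeights

/-- The degree at the vertex `v` of a weight `a` on the edges `{b, b + 1}` of the `n`-cycle. -/
def cycleDegree (n : ℕ) (a : ℕ → ℕ) (v : ℕ) : ℕ := a v + a (if v = 0 then n - 1 else v - 1)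

/-- The variables generating the colon ideal at the weight `a`. -/
def IsColonVariable (n : ℕ) (a : ℕ → ℕ) (v : ℕ) : Prop :=
  v + 1 < n ∧ (0 < a v ∨ v % 2 = 1 ∧ ∀ j < v, j % 2 = 0 → 0 < a j)

instance (n : ℕ) (a : ℕ → ℕ) (v : ℕ) : Decidable (IsColonVariable n a v) := by
  unfold IsColonVariable; infer_instance

/-- The weights that are minimal for the lexicographic order among those of the same degrees. -/
def IsStandardWeight (n : ℕ) (a : ℕ → ℕ) : Prop :=
  n % 2 = 1 ∨ ∃ j < n, j % 2 = 0 ∧ a j = 0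

instance (n : ℕ) (a : ℕ → ℕ) : Decidable (IsStandardWeight n a) := by
  unfold IsStandardWeight; infer_instance

/-- Suppose `b` has at least the degree of `a` at every colon variable. The first difference must
then be at position `0`, and the degree there forces `a (n - 1) < b (n - 1)`. Pairing consecutive
positions shows that the sum of `a` over the first `n - 1` positions is at most that of `b`, which
contradicts the equal totals. -/
theorem exists_isColonVariable_of_lex_lt {n : ℕ} (hn : 2 ≤ n) {a b : ℕ → ℕ}
    (hsum : ∑ j ∈ Finset.range n, a j = ∑ j ∈ Finset.range n, b j) {i : ℕ} (hi : i < n)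
    (heq : ∀ j < i, b j = a j) (hlt : b i < a i) (hstd : IsStandardWeight n a) :
    ∃ v, IsColonVariable n a v ∧ cycleDegree n b v < cycleDegree n a v := by
  by_contra! H
  have hlast : ∑ j ∈ Finset.range (n - 1), a j + a (n - 1) =
      ∑ j ∈ Finset.range (n - 1), b j + b (n - 1) := by
    rw [← Finset.sum_range_succ, ← Finset.sum_range_succ, show n - 1 + 1 = n by omega, hsum]
  have hi1 : i + 1 < n := by
    by_contra h
    obtain rfl : i = n - 1 := by omega
    have : ∑ j ∈ Finset.range (n - 1), b j = ∑ j ∈ Finset.range (n - 1), a j :=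
      Finset.sum_congr rfl fun j hj => heq j (Finset.mem_range.1 hj)
    omega
  have hHi := H i ⟨hi1, Or.inl (by omega)⟩
  unfold cycleDegree at H hHi
  obtain _ | i := i
  swap
  · have := heq i (by omega)
    simp only [Nat.add_eq_zero_iff, one_ne_zero, and_false, if_false, Nat.add_sub_cancel] at hHi
    omega
  rw [if_pos rfl] at hHi
  have hpair : ∀ v, IsColonVariable n a (v + 1) → a (v + 1) + a v ≤ b (v + 1) + b v := by
    intro v hv
    simpa using H _ hv
  -- Take the first even position where `b` catches up. Before it `a` is positive at even positions,
  -- so the odd ones are colon variables. For odd `n` the last position qualifies, and for even `n`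
  -- standardness supplies a zero of `a`.
  have hex : ∃ j, j < n ∧ j % 2 = 0 ∧ a j ≤ b j := by
    rcases hstd with h | ⟨j, hj, hj2, hj0⟩
    · exact ⟨n - 1, by omega, by omega, by omega⟩
    · exact ⟨j, hj, hj2, by omega⟩
  classical
  obtain ⟨hj, hj2, hjle⟩ := Nat.find_spec hex
  have hmin : ∀ m < Nat.find hex, m % 2 = 0 → 0 < a m := by
    intro m hm hm2
    have := Nat.find_min hex hm
    by_contra h0
    exact this ⟨by omega, hm2, by omega⟩
  generalize Nat.find hex = j at hj hj2 hjle hmin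
  have hpre : ∀ m, 2 * m ≤ j →
      ∑ l ∈ Finset.range (2 * m), a l ≤ ∑ l ∈ Finset.range (2 * m), b l := by
    intro m
    induction m with
    | zero => simp
    | succ m ih =>
      intro hm
      have h1 := ih (by omega)
      have h2 := hpair (2 * m) ⟨by omega, Or.inr ⟨by omega, fun l hl => hmin l (by omega)⟩⟩
      rw [show 2 * (m + 1) = 2 * m + 1 + 1 by ring, Finset.sum_range_succ, Finset.sum_range_succ,
        Finset.sum_range_succ _ (2 * m + 1), Finset.sum_range_succ _ (2 * m)]
      omega
  have hprej : ∑ l ∈ Finset.range j, a l ≤ ∑ l ∈ Finset.range j, b l := by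
    have := hpre (j / 2) (by omega)
    rwa [show 2 * (j / 2) = j by omega] at this
  by_cases hjn : j = n - 1
  · subst hjn
    omega
  -- Two consecutive prefix sums are carried along: when `a (m + 1) > b (m + 1)`, position `m + 1`
  -- is a colon variable, and its degree inequality advances the sum by two positions.
  have hall : ∀ m, j ≤ m → m + 1 < n →
      ∑ l ∈ Finset.range m, a l ≤ ∑ l ∈ Finset.range m, b l ∧
      ∑ l ∈ Finset.range (m + 1), a l ≤ ∑ l ∈ Finset.range (m + 1), b l := by
    intro m hm
    induction m, hm using Nat.le_induction with
    | base =>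
      intro _
      refine ⟨hprej, ?_⟩
      rw [Finset.sum_range_succ, Finset.sum_range_succ]
      omega
    | succ m hm ih =>
      intro hm1
      obtain ⟨h1, h2⟩ := ih (by omega)
      refine ⟨h2, ?_⟩
      rw [Finset.sum_range_succ, Finset.sum_range_succ _ (m + 1)]
      by_cases h3 : a (m + 1) ≤ b (m + 1)
      · omega
      · have h4 := hpair m ⟨hm1, Or.inl (by omega)⟩
        rw [Finset.sum_range_succ, Finset.sum_range_succ]
        omega
  have := (hall (n - 2) (by omega) (by omega)).2
  rw [show n - 2 + 1 = n - 1 by omega] at this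
  omega

/-- The degree bound says that the monomial of the earlier weight `b` divides `x_v` times that of
`a`. -/
theorem exists_lex_lt_of_isColonVariable {n : ℕ} {a : ℕ → ℕ} {v : ℕ}
    (hv : IsColonVariable n a v) : ∃ b : ℕ → ℕ,
      ∑ j ∈ Finset.range n, b j = ∑ j ∈ Finset.range n, a j ∧
      (∃ i < n, (∀ j < i, b j = a j) ∧ b i < a i) ∧
      ∀ u < n, cycleDegree n a u ≤ cycleDegree n b u + if u = v then 1 else 0 := by
  obtain ⟨hvn, h0 | ⟨hodd, hpos⟩⟩ := hv
  -- Move one unit from edge `v` to edge `v + 1`: among the degrees, only that at `v` drops.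
  · let b : ℕ → ℕ := fun j => if j = v then a j - 1 else if j = v + 1 then a j + 1 else a j
    have hb : ∀ j, (j = v ∧ b j + 1 = a j) ∨ (j = v + 1 ∧ b j = a j + 1) ∨
        (j ≠ v ∧ j ≠ v + 1 ∧ b j = a j) := by
      intro j
      dsimp only [b]
      split_ifs with h1
      · subst h1
        omega
      all_goals omega
    clear_value b
    refine ⟨b, ?_, ⟨v, by omega, fun j hj => by have := hb j; omega, by have := hb v; omega⟩, ?_⟩
    · have : ∀ m, ∑ j ∈ Finset.range m, b j + (if m = v + 1 then 1 else 0) =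
          ∑ j ∈ Finset.range m, a j := by
        intro m
        induction m with
        | zero => simp
        | succ m ih =>
          rw [Finset.sum_range_succ, Finset.sum_range_succ]
          have := hb m
          split_ifs at ih ⊢ <;> omega
      have := this n
      rwa [if_neg (by omega)] at this
    · intro u hu
      unfold cycleDegree
      have h1 := hb u
      have h2 := hb (n - 1)
      have h3 := hb (u - 1)
      split_ifs <;> omega
  -- Alternate `-1, +1, …, -1` on the edges before the odd position `v` and put the lost unit on the
  -- last edge. The changes cancel at the vertices `0, …, v - 1`, and the degree drops only at `v`.
  · let b : ℕ → ℕ := fun j => if j < v then if j % 2 = 0 then a j - 1 else a j + 1 else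
      if j = n - 1 then a j + 1 else a j
    have hb : ∀ j, (j < v ∧ j % 2 = 0 ∧ b j + 1 = a j) ∨ (j < v ∧ j % 2 = 1 ∧ b j = a j + 1) ∨
        (v ≤ j ∧ j = n - 1 ∧ b j = a j + 1) ∨ (v ≤ j ∧ j ≠ n - 1 ∧ b j = a j) := by
      intro j
      have := hpos j
      dsimp only [b]
      split_ifs <;> omega
    clear_value b
    refine ⟨b, ?_, ⟨0, by omega, fun j hj => by omega, by have := hb 0; omega⟩, ?_⟩
    · have : ∀ m ≤ n, ∑ j ∈ Finset.range m, b j +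
          (if m < v then m % 2 else if m < n then 1 else 0) = ∑ j ∈ Finset.range m, a j := by
        intro m
        induction m with
        | zero => simp; omega
        | succ m ih =>
          intro hm
          have ih := ih (by omega)
          rw [Finset.sum_range_succ, Finset.sum_range_succ]
          have := hb m
          split_ifs at ih ⊢ <;> omega
      have := this n le_rfl
      rwa [if_neg (by omega), if_neg (by omega)] at this
    · intro u hu
      unfold cycleDegree
      have h1 := hb u
      have h2 := hb (n - 1)
      have h3 := hb (u - 1)
      split_ifs <;> omega

/-- On an even cycle an alternating change of signs closes up, so it preserves every degree.
Positivity at the even positions makes it possible. -/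
theorem exists_lex_lt_of_not_isStandardWeight {n : ℕ} (hn : 2 ≤ n) {a : ℕ → ℕ}
    (h : ¬ IsStandardWeight n a) : ∃ b : ℕ → ℕ,
      ∑ j ∈ Finset.range n, b j = ∑ j ∈ Finset.range n, a j ∧
      (∃ i < n, (∀ j < i, b j = a j) ∧ b i < a i) ∧
      ∀ u < n, cycleDegree n a u = cycleDegree n b u := by
  unfold IsStandardWeight at h
  push Not at h
  obtain ⟨heven, hpos⟩ := h
  let b : ℕ → ℕ := fun j => if j % 2 = 0 then a j - 1 else a j + 1
  have hb : ∀ j < n, (j % 2 = 0 ∧ b j + 1 = a j) ∨ (j % 2 = 1 ∧ b j = a j + 1) := by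
    intro j hj
    have := hpos j hj
    dsimp only [b]
    split_ifs <;> omega
  clear_value b
  refine ⟨b, ?_, ⟨0, by omega, fun j hj => by omega, by have := hb 0 (by omega); omega⟩, ?_⟩
  · have : ∀ m ≤ n, ∑ j ∈ Finset.range m, b j + m % 2 = ∑ j ∈ Finset.range m, a j := by
      intro m
      induction m with
      | zero => simp
      | succ m ih =>
        intro hm
        have ih := ih (by omega)
        rw [Finset.sum_range_succ, Finset.sum_range_succ]
        have := hb m (by omega)
        omega
    have := this n le_rfl
    omega
  · intro u hu
    unfold cycleDegree
    have h1 := hb u hu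
    have h2 := hb (n - 1) (by omega)
    have h3 := hb (u - 1) (by omega)
    split_ifs <;> omega

end EdgeWeights

/-! ### Linear quotients for the powers of the path ideal. -/

section PathIdeal

open MvPolynomial

theorem Ideal.span_range_pow {R ι : Type*} [CommSemiring R] [Fintype ι] [DecidableEq ι] (f : ι → R)
    (t : ℕ) : Ideal.span (Set.range f) ^ t =
      Ideal.span ((fun w : ι → ℕ => ∏ i, f i ^ w i) '' {w | ∑ i, w i = t}) := by
  induction t with
  | zero =>
    rw [pow_zero, eq_comm, Ideal.one_eq_top, Ideal.eq_top_iff_one]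
    exact Ideal.subset_span ⟨0, by simp, by simp⟩
  | succ t ih =>
    rw [pow_succ, ih, Ideal.span_mul_span']
    congr 1
    have hprod : ∀ (w : ι → ℕ) (i : ι), ∏ l, f l ^ (w + Pi.single i 1 : ι → ℕ) l =
        (∏ l, f l ^ w l) * f i := by
      intro w i
      simp only [Pi.add_apply, pow_add, Finset.prod_mul_distrib]
      congr 1
      rw [Finset.prod_eq_single i]
      · simp
      · intro l _ hl
        simp [Pi.single_eq_of_ne hl]
      · simp
    ext x
    constructor
    · rintro ⟨_, ⟨w, hw, rfl⟩, _, ⟨i, rfl⟩, rfl⟩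
      refine ⟨(w + Pi.single i 1 : ι → ℕ), ?_, hprod w i⟩
      change ∑ l, (w + Pi.single i 1 : ι → ℕ) l = t + 1
      rw [← (show ∑ l, w l = t from hw)]
      simp [Finset.sum_add_distrib]
    · rintro ⟨w, hw, rfl⟩
      have hw' : ∑ l, w l = t + 1 := hw
      obtain ⟨i, -, hi⟩ := Finset.exists_ne_zero_of_sum_ne_zero
        (show ∑ l, w l ≠ 0 by omega)
      have hsplit : w = (w - Pi.single i 1) + Pi.single i 1 := by
        ext l
        by_cases h : l = i
        · subst h
          simp
          omega
        · simp [Pi.single_eq_of_ne h]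
      refine ⟨_, ⟨w - Pi.single i 1, ?_, rfl⟩, _, ⟨i, rfl⟩, ?_⟩
      · have h1 : ∑ l, ((w - Pi.single i 1) + Pi.single i 1 : ι → ℕ) l = t + 1 := hsplit ▸ hw'
        simp only [Pi.add_apply, Finset.sum_add_distrib] at h1
        simpa using h1
      · exact ((congrArg (fun u : ι → ℕ => ∏ l, f l ^ u l) hsplit).trans (hprod _ i)).symm

/-- Extension by zero of a weight on `Fin n`. -/
def extendZero {n : ℕ} (w : Fin n → ℕ) (m : ℕ) : ℕ := if h : m < n then w ⟨m, h⟩ else 0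

@[simp]
theorem extendZero_val {n : ℕ} (w : Fin n → ℕ) (v : Fin n) : extendZero w v = w v := by
  simp [extendZero]

theorem extendZero_of_lt {n : ℕ} (b : ℕ → ℕ) {m : ℕ} (hm : m < n) :
    extendZero (fun v : Fin n => b v) m = b m := by
  simp [extendZero, hm]

theorem sum_range_extendZero {n : ℕ} (w : Fin n → ℕ) :
    ∑ m ∈ Finset.range n, extendZero w m = ∑ v, w v := by
  simp [Finset.sum_range]

theorem sum_extendZero_of_lt {n : ℕ} (b : ℕ → ℕ) :
    ∑ v : Fin n, b v = ∑ m ∈ Finset.range n, b m := by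
  rw [Finset.sum_range]

variable (K : Type*) [Field K]

/-- The generator of the path ideal that omits the endpoints of the edge `{b, b + 1}`. -/
noncomputable def edgeComplement {n : ℕ} (b : Fin n) : MvPolynomial (Fin n) K :=
  ∏ r ∈ Finset.range (n - 2), X ⟨(((b : ℕ) + 2) % n + r) % n, Nat.mod_lt _ b.pos⟩

theorem cyclePathIdeal_eq_span_edgeComplement {n : ℕ} (hn : 2 ≤ n) :
    cyclePathIdeal K n (n - 2) = Ideal.span (Set.range (edgeComplement K (n := n))) := by
  rw [cyclePathIdeal]
  congr 1
  ext f
  constructor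
  · rintro ⟨a, rfl⟩
    refine ⟨⟨((a : ℕ) + (n - 2)) % n, Nat.mod_lt _ a.pos⟩, ?_⟩
    have : (((a : ℕ) + (n - 2)) % n + 2) % n = a := by
      rw [Nat.mod_add_mod, show (a : ℕ) + (n - 2) + 2 = a + n by omega, Nat.add_mod_right,
        Nat.mod_eq_of_lt a.isLt]
    simp only [edgeComplement, this]
  · rintro ⟨b, rfl⟩
    exact ⟨⟨((b : ℕ) + 2) % n, Nat.mod_lt _ b.pos⟩, rfl⟩

/-- The exponent vector of the product of the generators with multiplicities `w`. -/
noncomputable def weightExponent {n : ℕ} (w : Fin n → ℕ) : Fin n →₀ ℕ :=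
  Finsupp.equivFunOnFinite.symm fun v => ∑ b, w b - cycleDegree n (extendZero w) v

theorem mod_eq_ite {x n : ℕ} (h : x < 2 * n) : x % n = if x < n then x else x - n := by
  split_ifs with h1
  · exact Nat.mod_eq_of_lt h1
  · rw [Nat.mod_eq_sub_mod (by omega), Nat.mod_eq_of_lt (by omega)]

theorem edgeComplement_eq_prod {n : ℕ} (hn : 2 ≤ n) (b : Fin n) :
    edgeComplement K b = ∏ v ∈ Finset.univ.filter (fun v : Fin n => ¬ ((b : ℕ) = v ∨
      (b : ℕ) = if (v : ℕ) = 0 then n - 1 else v - 1)), X v := by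
  have hb := b.isLt
  have hval : ∀ r < n - 2, (((b : ℕ) + 2) % n + r) % n =
      if (b : ℕ) + 2 + r < n then b + 2 + r else b + 2 + r - n := by
    intro r hr
    rw [Nat.mod_add_mod, mod_eq_ite (by omega)]
  refine Finset.prod_bij (fun r _ => ⟨(((b : ℕ) + 2) % n + r) % n, Nat.mod_lt _ b.pos⟩) ?_ ?_ ?_ ?_
  · intro r hr
    have h := hval r (Finset.mem_range.1 hr)
    have hr' := Finset.mem_range.1 hr
    rw [Finset.mem_filter]
    refine ⟨Finset.mem_univ _, ?_⟩
    simp only [h]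
    split_ifs <;> omega
  · intro r hr s hs hrs
    have hr' := Finset.mem_range.1 hr
    have hs' := Finset.mem_range.1 hs
    have h1 := Fin.val_eq_of_eq hrs
    simp only [hval r hr', hval s hs'] at h1
    split_ifs at h1 <;> omega
  · intro v hv
    have hv' := (Finset.mem_filter.1 hv).2
    have hvn := v.isLt
    have hlt : (if (b : ℕ) + 2 ≤ v then (v : ℕ) - b - 2 else v + n - b - 2) < n - 2 := by
      split_ifs at hv' ⊢ <;> omega
    refine ⟨_, Finset.mem_range.2 hlt, ?_⟩
    apply Fin.ext
    simp only [hval _ hlt]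
    split_ifs at hv' ⊢ <;> omega
  · intro r _
    rfl

/-- Edge `b` contributes to the exponent of `x_v` unless `v` is one of its ends. The truncated
subtraction in `weightExponent` is exact because for `n ≥ 2` the two edges at `v` are distinct. -/
theorem prod_edgeComplement_pow {n : ℕ} (hn : 2 ≤ n) (w : Fin n → ℕ) :
    ∏ b, edgeComplement K b ^ w b = monomial (weightExponent w) 1 := by
  have h : ∀ v : Fin n, ∑ b : Fin n, (if ¬ ((b : ℕ) = v ∨ (b : ℕ) = if (v : ℕ) = 0 then n - 1 else v - 1)
      then w b else 0) = weightExponent w v := by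
    intro v
    have hv := v.isLt
    obtain ⟨p, hp⟩ : ∃ p : Fin n, (p : ℕ) = if (v : ℕ) = 0 then n - 1 else v - 1 :=
      ⟨⟨if (v : ℕ) = 0 then n - 1 else v - 1, by split_ifs <;> omega⟩, rfl⟩
    have hpv : p ≠ v := by
      rintro rfl
      split_ifs at hp <;> omega
    simp only [weightExponent, Finsupp.equivFunOnFinite_symm_apply_apply, cycleDegree, ← hp,
      extendZero_val]
    apply Nat.eq_sub_of_add_eq
    have h1 : ∑ b, (if b = v then w b else 0) = w v := by simp
    have h2 : ∑ b, (if b = p then w b else 0) = w p := by simp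
    conv_lhs => rw [← h1, ← h2, ← Finset.sum_add_distrib, ← Finset.sum_add_distrib]
    refine Finset.sum_congr rfl fun b _ => ?_
    simp only [← Fin.ext_iff]
    by_cases h3 : b = v
    · subst h3
      simp [hpv.symm]
    · by_cases h4 : b = p
      · simp [h4, hpv]
      · simp [h3, h4]
  rw [monomial_eq, map_one, one_mul, Finsupp.prod_fintype _ _ (by simp)]
  simp only [edgeComplement_eq_prod K hn, ← h, Finset.prod_filter, ← Finset.prod_pow,
    ← Finset.prod_pow_eq_pow_sum]
  rw [Finset.prod_comm]
  refine Finset.prod_congr rfl fun v _ => Finset.prod_congr rfl fun b _ => ?_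
  split_ifs <;> simp

theorem isHomogeneous_prod_edgeComplement_pow {n t : ℕ} {w : Fin n → ℕ} (hw : ∑ b, w b = t) :
    (∏ b, edgeComplement K b ^ w b).IsHomogeneous ((n - 2) * t) := by
  rw [← hw, Finset.mul_sum]
  refine IsHomogeneous.prod _ _ _ fun b _ => IsHomogeneous.pow ?_ _
  have := IsHomogeneous.prod (Finset.range (n - 2)) (fun r =>
    (X ⟨(((b : ℕ) + 2) % n + r) % n, Nat.mod_lt _ b.pos⟩ : MvPolynomial (Fin n) K)) (fun _ => 1)
    fun r _ => isHomogeneous_X K _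
  rwa [Finset.sum_const, Finset.card_range, smul_eq_mul, mul_one] at this

/-- The powers of the path ideal have linear quotients, hence a linear resolution. -/
theorem linearRes_cyclePathIdeal_pow {n : ℕ} (hn : 2 ≤ n) (t : ℕ) :
    ∃ p, LinearRes p (idealSub (cyclePathIdeal K n (n - 2) ^ t)) ((n - 2) * t) (fun i =>
      ∑ w ∈ (Finset.univ : Finset (Fin n)).piAntidiag t with IsStandardWeight n (extendZero w),
        (Finset.univ.filter fun v : Fin n => IsColonVariable n (extendZero w) v).card.choose i) := by
  let T : Finset (Lex (Fin n → ℕ)) :=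
    ((Finset.univ : Finset (Fin n)).piAntidiag t).map toLex.toEmbedding
  have hT : ∀ w : Fin n → ℕ, toLex w ∈ T ↔ ∑ b, w b = t := by
    intro w
    simp [T, Finset.mem_piAntidiag]
  let g : Lex (Fin n → ℕ) → MvPolynomial (Fin n) K := fun w => monomial (weightExponent (ofLex w)) 1
  have hJ : cyclePathIdeal K n (n - 2) ^ t = Ideal.span (g '' T) := by
    rw [cyclePathIdeal_eq_span_edgeComplement K hn, Ideal.span_range_pow]
    congr 1
    ext f
    constructor
    · rintro ⟨w, hw, rfl⟩
      exact ⟨toLex w, (hT w).2 hw, (prod_edgeComplement_pow K hn w).symm⟩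
    · rintro ⟨w, hw, rfl⟩
      exact ⟨ofLex w, (hT (ofLex w)).1 hw, prod_edgeComplement_pow K hn (ofLex w)⟩
  -- an earlier weight, from a function on the natural numbers
  have hprev : ∀ (w : Fin n → ℕ) (_ : ∑ b, w b = t) (b : ℕ → ℕ)
      (_ : ∑ j ∈ Finset.range n, b j = ∑ j ∈ Finset.range n, extendZero w j)
      (_ : ∃ i < n, (∀ j < i, b j = extendZero w j) ∧ b i < extendZero w i),
      toLex (fun v : Fin n => b v) ∈ {w' | w' ∈ T ∧ w' < toLex w} := by
    rintro w hw b hb ⟨i, hi, hi1, hi2⟩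
    refine ⟨(hT _).2 ?_, ⟨i, hi⟩, fun j hj => ?_, ?_⟩
    · rw [sum_extendZero_of_lt, hb, sum_range_extendZero, hw]
    · exact (hi1 j hj).trans (extendZero_val w j)
    · exact hi2.trans_eq (extendZero_val w ⟨i, hi⟩)
  have hexp : ∀ (w : Fin n → ℕ) (v : Fin n), ∑ b, w b = t →
      weightExponent w v = t - cycleDegree n (extendZero w) v := by
    intro w v hw
    simp [weightExponent, hw]
  have hdeg : ∀ (b : ℕ → ℕ) (u : Fin n), cycleDegree n (extendZero fun v : Fin n => b v) u =
      cycleDegree n b u := by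
    intro b u
    have hu := u.isLt
    unfold cycleDegree
    rw [extendZero_of_lt b hu, extendZero_of_lt b (by split_ifs <;> omega)]
  have hspan : ∀ s : Set (Lex (Fin n → ℕ)), Ideal.span (g '' s) =
      Ideal.span ((fun m => monomial m (1 : K)) '' ((fun w => weightExponent (ofLex w)) '' s)) := by
    intro s
    rw [Set.image_image]
  refine (linearRes_of_linearQuotients (d := (n - 2) * t) T g ?_
    (fun w => IsStandardWeight n (extendZero (ofLex w)))
    (fun w => Finset.univ.filter fun v : Fin n => IsColonVariable n (extendZero (ofLex w)) v) ?_ ?_).imp fun p hp => ?_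
  · intro w hw
    have := isHomogeneous_prod_edgeComplement_pow K ((hT (ofLex w)).1 hw)
    rwa [prod_edgeComplement_pow K hn] at this
  · intro w hw hstd f
    have hw := (hT (ofLex w)).1 hw
    constructor
    · intro hf
      have hle : Ideal.span ((X : Fin n → MvPolynomial (Fin n) K) ''
          (Finset.univ.filter fun v : Fin n => IsColonVariable n (extendZero (ofLex w)) v)) ≤
          Submodule.comap (LinearMap.mulRight (MvPolynomial (Fin n) K) (g w))
            (Ideal.span (g '' {w' | w' ∈ T ∧ w' < w})) := by
        rw [Ideal.span_le]
        rintro _ ⟨v, hv, rfl⟩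
        have hv := (Finset.mem_filter.1 hv).2
        obtain ⟨b, hb1, hb2, hb3⟩ := exists_lex_lt_of_isColonVariable hv
        have hmem := hprev (ofLex w) hw b hb1 hb2
        have hbt := (hT _).1 hmem.1
        change X v * g w ∈ Ideal.span (g '' {w' | w' ∈ T ∧ w' < w})
        refine Ideal.mem_of_dvd _ ?_ (Ideal.subset_span ⟨_, hmem, rfl⟩)
        -- Divisibility is compared exponent by exponent, where it is the degree bound on `b`.
        rw [X, monomial_mul, mul_one]
        refine (monomial_dvd_monomial).2 ⟨Or.inr fun u => ?_, dvd_rfl⟩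
        have h1 := hb3 u u.isLt
        change weightExponent (fun v : Fin n => b v) u ≤ _
        rw [hexp _ _ hbt, hdeg, Finsupp.add_apply, hexp _ _ hw, Finsupp.single_apply]
        simp only [Fin.ext_iff, eq_comm (a := (v : ℕ))]
        split_ifs at h1 ⊢ <;> omega
      exact hle hf
    · intro hf
      rw [hspan, mem_ideal_span_monomial_image] at hf
      rw [mem_ideal_span_X_image]
      intro m hm
      obtain ⟨_, ⟨w', ⟨hw'T, i, hi1, hi2⟩, rfl⟩, hle⟩ := hf (m + weightExponent (ofLex w)) (by
        rw [mem_support_iff, coeff_mul_monomial, mul_one]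
        exact mem_support_iff.1 hm)
      have hw' := (hT (ofLex w')).1 hw'T
      obtain ⟨v, hv, hlt⟩ := exists_isColonVariable_of_lex_lt hn (a := extendZero (ofLex w))
        (b := extendZero (ofLex w')) (by rw [sum_range_extendZero, sum_range_extendZero, hw, hw'])
        i.isLt (fun j hj => by
          have := hi1 ⟨j, hj.trans i.isLt⟩ hj
          simpa [extendZero, hj.trans i.isLt] using this)
        (by simpa using hi2) hstd
      have hvn : v < n := by have := hv.1; omega
      refine ⟨⟨v, hvn⟩, by simpa using hv, ?_⟩
      have h1 := hle ⟨v, hvn⟩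
      rw [Finsupp.add_apply, hexp _ _ hw, hexp _ _ hw'] at h1
      -- Without this bound, truncated subtraction could hide the strict drop of degree that forces
      -- `x_v` to divide the monomial `m`.
      have h2 : cycleDegree n (extendZero (ofLex w)) v ≤ t := by
        obtain ⟨q, hq⟩ : ∃ q : Fin n, (q : ℕ) = if v = 0 then n - 1 else v - 1 :=
          ⟨⟨if v = 0 then n - 1 else v - 1, by split_ifs <;> omega⟩, rfl⟩
        have hqv : (⟨v, hvn⟩ : Fin n) ≠ q := by
          intro h
          have := Fin.val_eq_of_eq h
          simp only at this
          split_ifs at hq <;> omega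
        rw [cycleDegree, ← hq, extendZero_val, ← hw]
        have := extendZero_val (ofLex w) ⟨v, hvn⟩
        simp only at this
        rw [this, ← Finset.sum_pair hqv (f := ofLex w)]
        exact Finset.sum_le_sum_of_subset (Finset.subset_univ _)
      simp only at h1
      omega
  · intro w hw hstd
    have hw := (hT (ofLex w)).1 hw
    obtain ⟨b, hb1, hb2, hb3⟩ := exists_lex_lt_of_not_isStandardWeight hn hstd
    have hmem := hprev (ofLex w) hw b hb1 hb2
    have hbt := (hT _).1 hmem.1
    refine Ideal.subset_span ⟨_, hmem, ?_⟩
    change monomial (weightExponent fun v : Fin n => b v) 1 = monomial (weightExponent (ofLex w)) 1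
    refine congrArg (fun m => monomial m 1) (Finsupp.ext fun u => ?_)
    rw [hexp _ _ hbt, hdeg, hexp _ _ hw, hb3 u u.isLt]
  · rw [hJ]
    convert hp using 2 with i
    simp only [T, Finset.filter_map, Finset.sum_map]
    rfl

end PathIdeal

/-! ### Generating function of the standard weights. -/

section Counting

variable {R : Type*} [CommRing R]

theorem PowerSeries.coeff_prod_mk {ι : Type*} [Fintype ι] [DecidableEq ι] (φ : ι → ℕ → R) (t : ℕ) :
    PowerSeries.coeff t (∏ v, PowerSeries.mk (φ v)) =
      ∑ w ∈ (Finset.univ : Finset ι).piAntidiag t, ∏ v, φ v (w v) := by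
  rw [PowerSeries.coeff_prod]
  simp only [PowerSeries.coeff_mk]
  refine Finset.sum_nbij' (fun l => (l : ι → ℕ)) (fun w => Finsupp.equivFunOnFinite.symm w)
    ?_ ?_ ?_ ?_ ?_
  · intro l hl
    simpa using hl
  · intro w hw
    simpa using hw
  · intro l _
    ext
    rfl
  · intro w _
    rfl
  · intro l _
    rfl

/-- The contribution of the value `x` at position `v` to the weights whose first vanishing even
position is `2 * J`. -/
def positionFactor (n : ℕ) (Z : R) (J v x : ℕ) : R :=
  if v + 1 = n then 1
  else if v < 2 * J then (if v % 2 = 0 then (if x = 0 then 0 else Z) else Z)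
  else if v = 2 * J then (if x = 0 then 1 else 0)
  else (if x = 0 then 1 else Z)

/-- For a standard weight exactly one `J` survives, the one marking the first zero at an even
position; for other weights none does. The last position is never a colon variable and has factor
`1`. For odd `n` the index `2 * J = n - 1` thus collects the weights with no earlier even zero. -/
theorem sum_prod_positionFactor {n : ℕ} (Z : R) (w : Fin n → ℕ) :
    ∑ J ∈ Finset.range ((n + 1) / 2), ∏ v : Fin n, positionFactor n Z J v (w v) =
      if IsStandardWeight n (extendZero w) then
        Z ^ (Finset.univ.filter fun v : Fin n => IsColonVariable n (extendZero w) v).card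
      else 0 := by
  have hzero : ∀ (J m : ℕ), m + 1 < n → positionFactor n Z J m (extendZero w m) = 0 →
      ∏ v : Fin n, positionFactor n Z J v (w v) = 0 := by
    intro J m hm h
    refine Finset.prod_eq_zero (i := ⟨m, by omega⟩) (Finset.mem_univ _) ?_
    rw [← extendZero_val w]
    exact h
  split_ifs with hstd
  · have hex : ∃ J, 2 * J < n ∧ (2 * J + 1 = n ∨ extendZero w (2 * J) = 0) := by
      rcases hstd with h | ⟨j, hj, hj2, hj0⟩
      · exact ⟨n / 2, by omega, by omega⟩
      · exact ⟨j / 2, by omega, by rw [show 2 * (j / 2) = j by omega]; exact Or.inr hj0⟩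
    classical
    obtain ⟨hJn, hJ⟩ := Nat.find_spec hex
    have hmin : ∀ m < Nat.find hex, 0 < extendZero w (2 * m) := by
      intro m hm
      have := Nat.find_min hex hm
      by_contra h0
      exact this ⟨by omega, Or.inr (by omega)⟩
    generalize Nat.find hex = J at hJn hJ hmin
    have hpos : ∀ v < 2 * J, v % 2 = 0 → 0 < extendZero w v := by
      intro v hv hv2
      have := hmin (v / 2) (by omega)
      rwa [show 2 * (v / 2) = v by omega] at this
    rw [Finset.sum_eq_single J]
    · rw [← Finset.prod_const, Finset.prod_filter]
      refine Finset.prod_congr rfl fun v _ => ?_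
      rw [← extendZero_val w]
      have hv := v.isLt
      generalize (v : ℕ) = v at hv
      unfold positionFactor
      by_cases h1 : v + 1 = n
      · rw [if_pos h1, if_neg fun h => by have := h.1; omega]
      rw [if_neg h1]
      by_cases h2 : v < 2 * J
      · rw [if_pos h2]
        by_cases h3 : v % 2 = 0
        · have := hpos v h2 h3
          rw [if_pos h3, if_neg (by omega), if_pos ⟨by omega, Or.inl this⟩]
        · rw [if_neg h3, if_pos ⟨by omega, Or.inr ⟨by omega, fun j hj => hpos j (by omega)⟩⟩]
      rw [if_neg h2]
      by_cases h3 : v = 2 * J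
      · have h4 : extendZero w v = 0 := by
          subst h3
          omega
        rw [if_pos h3, if_pos h4, if_neg]
        rintro ⟨_, h | h⟩ <;> omega
      rw [if_neg h3]
      by_cases h4 : extendZero w v = 0
      · rw [if_pos h4, if_neg]
        rintro ⟨_, h | ⟨_, h⟩⟩
        · omega
        · have := h (2 * J) (by omega) (by omega)
          omega
      · rw [if_neg h4, if_pos ⟨by omega, Or.inl (by omega)⟩]
    · intro J' hJ' hne
      have hJ'n := Finset.mem_range.1 hJ'
      rcases lt_or_gt_of_ne hne with h | h
      · refine hzero J' (2 * J') (by omega) ?_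
        have := hmin J' h
        unfold positionFactor
        rw [if_neg (by omega), if_neg (by omega), if_pos rfl, if_neg (by omega)]
      · refine hzero J' (2 * J) (by omega) ?_
        unfold positionFactor
        rw [if_neg (by omega), if_pos (by omega), if_pos (by omega), if_pos (by omega)]
    · intro h
      exact absurd (Finset.mem_range.2 (by omega)) h
  · unfold IsStandardWeight at hstd
    push Not at hstd
    obtain ⟨h2, hpos⟩ := hstd
    refine Finset.sum_eq_zero fun J hJ => ?_
    have hJ := Finset.mem_range.1 hJ
    refine hzero J (2 * J) (by omega) ?_
    have := hpos (2 * J) (by omega) (by omega)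
    unfold positionFactor
    rw [if_neg (by omega), if_neg (by omega), if_pos rfl, if_neg this]

open PowerSeries in
/-- The generating function of the standard weights of sum `t` by the number of colon variables. -/
noncomputable def standardSeries (n : ℕ) (Z : R) : PowerSeries R :=
  mk fun t => ∑ w ∈ (Finset.univ : Finset (Fin n)).piAntidiag t with
    IsStandardWeight n (extendZero w),
      Z ^ (Finset.univ.filter fun v : Fin n => IsColonVariable n (extendZero w) v).card

open PowerSeries

theorem standardSeries_eq_sum (n : ℕ) (Z : R) :
    standardSeries n Z = ∑ J ∈ Finset.range ((n + 1) / 2),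
      ∏ v ∈ Finset.range n, mk (positionFactor n Z J v) := by
  ext t
  rw [standardSeries, coeff_mk, map_sum, Finset.sum_filter]
  simp only [Finset.prod_range, coeff_prod_mk]
  rw [Finset.sum_comm]
  exact Finset.sum_congr rfl fun w _ => (sum_prod_positionFactor Z w).symm

theorem one_sub_X_mul_mk (f : ℕ → R) (h : PowerSeries R) (h0 : coeff 0 h = f 0)
    (h1 : ∀ m, coeff (m + 1) h = f (m + 1) - f m) : (1 - X) * mk f = h := by
  ext m
  cases m with
  | zero => simpa [sub_mul] using h0.symm
  | succ m => rw [sub_mul, one_mul, map_sub, coeff_succ_X_mul, coeff_mk, coeff_mk, h1]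

/-- Each factor is eventually constant in the value, so multiplying by `1 - X` leaves a polynomial.
-/
theorem one_sub_X_mul_positionFactor (n : ℕ) (Z : R) (J v : ℕ) :
    (1 - X) * mk (positionFactor n Z J v) =
      if v + 1 = n then 1
      else if v < 2 * J then (if v % 2 = 0 then C Z * X else C Z)
      else if v = 2 * J then 1 - X
      else 1 + C (Z - 1) * X := by
  split_ifs with h1 h2 h3 h4
  · refine one_sub_X_mul_mk _ _ (by simp [positionFactor, h1]) fun m => ?_
    simp [positionFactor, h1, coeff_one]
  · refine one_sub_X_mul_mk _ _ (by simp [positionFactor, h1, h2, h3]) fun m => ?_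
    cases m <;> simp [positionFactor, h1, h2, h3]
  · refine one_sub_X_mul_mk _ _ (by simp [positionFactor, h1, h2, h3]) fun m => ?_
    simp [positionFactor, h1, h2, h3]
  · subst h4
    refine one_sub_X_mul_mk _ _ (by simp [positionFactor, h1]) fun m => ?_
    cases m <;> simp [positionFactor, h1, coeff_X, coeff_one]
  · refine one_sub_X_mul_mk _ _ (by simp [positionFactor, h1, h2, h4]) fun m => ?_
    cases m <;> simp [positionFactor, h1, h2, h4, coeff_one]

theorem prod_positionFactor_even (n : ℕ) (Z : R) (J : ℕ) (h : 2 * J < n) (m : ℕ) (hm : m ≤ J) :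
    ∏ v ∈ Finset.range (2 * m), ((1 - X) * mk (positionFactor n Z J v)) =
      (C Z * X * C Z) ^ m := by
  induction m with
  | zero => simp
  | succ m ih =>
    rw [show 2 * (m + 1) = 2 * m + 1 + 1 by ring, Finset.prod_range_succ, Finset.prod_range_succ,
      ih (by omega), one_sub_X_mul_positionFactor, one_sub_X_mul_positionFactor, if_neg (by omega),
      if_pos (by omega), if_pos (by omega), if_neg (by omega), if_pos (by omega),
      if_neg (by omega), pow_succ, mul_assoc, mul_assoc]

theorem prod_positionFactor_middle (n : ℕ) (Z : R) (J : ℕ) (r : ℕ) (hr : 2 * J + 1 + r < n) :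
    ∏ v ∈ Finset.range (2 * J + 1 + r), ((1 - X) * mk (positionFactor n Z J v)) =
      (C Z * X * C Z) ^ J * (1 - X) * (1 + C (Z - 1) * X) ^ r := by
  induction r with
  | zero =>
    rw [add_zero, Finset.prod_range_succ, prod_positionFactor_even n Z J (by omega) J le_rfl,
      one_sub_X_mul_positionFactor, if_neg (by omega), if_neg (by omega), if_pos rfl, pow_zero,
      mul_one]
  | succ r ih =>
    rw [← add_assoc, Finset.prod_range_succ, ih (by omega), one_sub_X_mul_positionFactor,
      if_neg (by omega), if_neg (by omega), if_neg (by omega), pow_succ]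
    ring

theorem pow_mul_prod_positionFactor (n : ℕ) (Z : R) (J : ℕ) :
    (1 - X) ^ n * ∏ v ∈ Finset.range n, mk (positionFactor n Z J v) =
      ∏ v ∈ Finset.range n, ((1 - X) * mk (positionFactor n Z J v)) := by
  rw [Finset.prod_mul_distrib, Finset.prod_const, Finset.card_range]

theorem pow_mul_prod_positionFactor_of_lt (n : ℕ) (Z : R) (J : ℕ) (h : 2 * J + 1 < n) :
    (1 - X) ^ n * ∏ v ∈ Finset.range n, mk (positionFactor n Z J v) =
      (C Z * X * C Z) ^ J * (1 - X) * (1 + C (Z - 1) * X) ^ (n - 2 - 2 * J) := by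
  rw [pow_mul_prod_positionFactor]
  obtain ⟨r, rfl⟩ : ∃ r, n = 2 * J + 1 + r + 1 := ⟨n - 2 * J - 2, by omega⟩
  rw [Finset.prod_range_succ, prod_positionFactor_middle _ Z J r (by omega),
    one_sub_X_mul_positionFactor, if_pos rfl, mul_one]
  congr 2
  omega

theorem pow_mul_prod_positionFactor_of_eq (Z : R) (J : ℕ) :
    (1 - X) ^ (2 * J + 1) * ∏ v ∈ Finset.range (2 * J + 1), mk (positionFactor (2 * J + 1) Z J v) =
      (C Z * X * C Z) ^ J := by
  rw [pow_mul_prod_positionFactor, Finset.prod_range_succ,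
    prod_positionFactor_even _ Z J (by omega) J le_rfl, one_sub_X_mul_positionFactor, if_pos rfl,
    mul_one]

/-- Telescoping works because `(1 - z²X)(1 - X) = (1 + zX)² - (1 + z)²X`. -/
theorem geom_sum_identity (z : R) (k : ℕ) :
    (1 - C (z ^ 2) * X) * ∑ J ∈ Finset.range k, ((C (1 + z) * X * C (1 + z)) ^ J * (1 - X) *
      ((1 + C z * X) ^ 2) ^ (k - 1 - J)) =
      (1 + C z * X) ^ (2 * k) - C (1 + z) ^ (2 * k) * X ^ k := by
  have h := (Commute.all (C (1 + z) * X * C (1 + z)) ((1 + C z * X) ^ 2)).geom_sum₂_mul k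
  have h2 : ((C (1 + z) * X * C (1 + z) : PowerSeries R)) ^ k =
      C (1 + z) ^ (2 * k) * X ^ k := by
    rw [pow_mul, ← mul_pow]
    ring
  rw [← h2, pow_mul, ← neg_sub ((C (1 + z) * X * C (1 + z)) ^ k), ← h, Finset.mul_sum, Finset.sum_mul, ← Finset.sum_neg_distrib]
  refine Finset.sum_congr rfl fun J _ => ?_
  simp only [map_add, map_one, map_pow]
  ring

theorem standardSeries_even (z : R) (k : ℕ) :
    (1 - C (z ^ 2) * X) * ((1 - X) ^ (2 * k) * standardSeries (2 * k) (1 + z)) =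
      (1 + C z * X) ^ (2 * k) - C (1 + z) ^ (2 * k) * X ^ k := by
  rw [standardSeries_eq_sum, show (2 * k + 1) / 2 = k by omega, ← geom_sum_identity]
  congr 1
  rw [Finset.mul_sum]
  refine Finset.sum_congr rfl fun J hJ => ?_
  have hJ := Finset.mem_range.1 hJ
  rw [pow_mul_prod_positionFactor_of_lt _ _ _ (by omega), add_sub_cancel_left, ← pow_mul]
  congr 2
  omega

theorem standardSeries_odd (z : R) (k : ℕ) :
    (1 - C (z ^ 2) * X) * ((1 - X) ^ (2 * k + 1) * standardSeries (2 * k + 1) (1 + z)) =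
      (1 + C z * X) ^ (2 * k + 1) - C z * C (1 + z) ^ (2 * k + 1) * X ^ (k + 1) := by
  have h2 : ((C (1 + z) * X * C (1 + z) : PowerSeries R)) ^ k =
      C (1 + z) ^ (2 * k) * X ^ k := by
    rw [pow_mul, ← mul_pow]
    ring
  -- Compared with the even case, every term with `J < k` gains one free position, hence a factor `1
  -- + zX`. The term `J = k` stands apart: its marked position is the last one, so it lacks the
  -- factor `1 - X`.
  have hsum : (1 - X) ^ (2 * k + 1) * standardSeries (2 * k + 1) (1 + z) =
      (1 + C z * X) * ∑ J ∈ Finset.range k, ((C (1 + z) * X * C (1 + z)) ^ J * (1 - X) *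
      ((1 + C z * X) ^ 2) ^ (k - 1 - J)) + C (1 + z) ^ (2 * k) * X ^ k := by
    rw [standardSeries_eq_sum, show (2 * k + 1 + 1) / 2 = k + 1 by omega,
      Finset.sum_range_succ, mul_add, pow_mul_prod_positionFactor_of_eq, h2, Finset.mul_sum,
      Finset.mul_sum]
    congr 1
    refine Finset.sum_congr rfl fun J hJ => ?_
    have hJ := Finset.mem_range.1 hJ
    rw [pow_mul_prod_positionFactor_of_lt _ _ _ (by omega), add_sub_cancel_left, ← pow_mul,
      show 2 * k + 1 - 2 - 2 * J = 2 * (k - 1 - J) + 1 by omega, pow_succ]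
    ring
  rw [hsum, mul_add, mul_left_comm, geom_sum_identity]
  simp only [map_add, map_one, map_pow]
  ring

end Counting

/-! ### Extraction of coefficients. -/

section Coefficients

open PowerSeries

/-- The inverse of `(1 - z²u)(1 - u)ⁿ` as a power series in `u` over `ℤ[z]`. -/
noncomputable def inverseSeries (n : ℕ) : PowerSeries (Polynomial ℤ) :=
  mk (fun j => Polynomial.X ^ (2 * j)) * mk 1 ^ n

theorem mul_inverseSeries (n : ℕ) :
    (1 - C (Polynomial.X ^ 2) * X) * (1 - X) ^ n * inverseSeries n = 1 := by
  have h1 : (1 - X) ^ n * (mk 1 : PowerSeries (Polynomial ℤ)) ^ n = 1 := by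
    rw [← mul_pow, mul_comm, mk_one_mul_one_sub_eq_one, one_pow]
  have h2 : (1 - C (Polynomial.X ^ 2) * X) *
      (mk (fun j => Polynomial.X ^ (2 * j)) : PowerSeries (Polynomial ℤ)) = 1 := by
    ext1 m
    rw [sub_mul, one_mul, map_sub, coeff_mk, mul_assoc, coeff_C_mul]
    cases m with
    | zero => simp
    | succ m =>
      rw [coeff_succ_X_mul, coeff_mk, coeff_one, if_neg (by omega)]
      ring
  rw [inverseSeries, mul_mul_mul_comm, h2, h1, one_mul]

theorem eq_mul_inverseSeries {n : ℕ} {F G : PowerSeries (Polynomial ℤ)}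
    (h : (1 - C (Polynomial.X ^ 2) * X) * ((1 - X) ^ n * F) = G) : F = G * inverseSeries n := by
  rw [← h, ← mul_assoc, mul_right_comm, mul_inverseSeries, one_mul]

theorem coeff_inverseSeries (d t i : ℕ) :
    (coeff t (inverseSeries (d + 1))).coeff i =
      if i % 2 = 0 ∧ i / 2 ≤ t then ((d + (t - i / 2)).choose d : ℤ) else 0 := by
  have h : ∀ p : ℕ × ℕ, (coeff p.1 (mk fun j => (Polynomial.X : Polynomial ℤ) ^ (2 * j)) *
      coeff p.2 (mk fun m => ((d + m).choose d : Polynomial ℤ))).coeff i =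
      if i = 2 * p.1 then ((d + p.2).choose d : ℤ) else 0 := by
    intro p
    rw [coeff_mk, coeff_mk, Polynomial.coeff_mul_natCast, Polynomial.coeff_X_pow]
    split_ifs <;> simp
  rw [inverseSeries, mk_one_pow_eq_mk_choose_add, coeff_mul, Polynomial.finsetSum_coeff,
    Finset.sum_congr rfl fun p _ => h p]
  split_ifs with hi
  · rw [Finset.sum_eq_single (i / 2, t - i / 2)]
    · rw [if_pos (by dsimp only; omega)]
    · rintro ⟨a, b⟩ hab hne
      rw [Finset.HasAntidiagonal.mem_antidiagonal] at hab
      rw [if_neg]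
      rintro rfl
      apply hne
      ext <;> simp at hab ⊢
      omega
    · intro hn
      exact absurd (Finset.HasAntidiagonal.mem_antidiagonal.2 (by dsimp only; omega)) hn
  · refine Finset.sum_eq_zero fun p hp => if_neg fun h => hi ?_
    rw [Finset.HasAntidiagonal.mem_antidiagonal] at hp
    omega

theorem coeff_monomial_mul (F : PowerSeries (Polynomial ℤ)) (a b t i : ℕ) :
    (coeff t (C (Polynomial.X ^ a) * X ^ b * F)).coeff i =
      if b ≤ t ∧ a ≤ i then (coeff (t - b) F).coeff (i - a) else 0 := by
  rw [mul_assoc, coeff_C_mul, coeff_X_pow_mul']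
  by_cases hb : b ≤ t
  · rw [if_pos hb, Polynomial.coeff_X_pow_mul']
    simp [hb]
  · simp [hb]

theorem coeff_natCast_mul_coeff (m t i : ℕ) (F : PowerSeries (Polynomial ℤ)) :
    (coeff t ((m : PowerSeries (Polynomial ℤ)) * F)).coeff i = m * (coeff t F).coeff i := by
  rw [← nsmul_eq_mul, map_nsmul, Polynomial.coeff_smul, nsmul_eq_mul]

/-- The inverse series contains only even powers of `z`, so the exponent `a` taken from the binomial
expansion has the parity of `i`, and `a = i - 2 * j`. -/
theorem sum_choose_mul_reindex (n i : ℕ) (h : ℕ → ℤ)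
    (h0 : ∀ a, ¬ (a ≤ i ∧ (i - a) % 2 = 0) → h a = 0) :
    ∑ a ∈ Finset.range (n + 1), (n.choose a : ℤ) * h a =
      ∑ j ∈ Finset.range (i / 2 + 1), (n.choose (i - 2 * j) : ℤ) * h (i - 2 * j) := by
  have h1 : ∑ a ∈ Finset.range (n + 1), (n.choose a : ℤ) * h a =
      ∑ a ∈ Finset.range (n + 1 + i), (n.choose a : ℤ) * h a := by
    refine Finset.sum_subset (Finset.range_mono (by omega)) fun a _ ha => ?_
    rw [Finset.mem_range] at ha
    rw [Nat.choose_eq_zero_of_lt (by omega), Nat.cast_zero, zero_mul]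
  rw [h1]
  symm
  refine Finset.sum_of_injOn (fun j => i - 2 * j) ?_ ?_ ?_ fun _ _ => rfl
  · intro a ha b hb hab
    simp only [Finset.coe_range, Set.mem_Iio] at ha hb hab
    omega
  · intro a ha
    simp only [Finset.coe_range, Set.mem_Iio] at ha ⊢
    omega
  · intro a _ ha
    rw [h0, mul_zero]
    rintro ⟨h2, h3⟩
    exact ha ⟨(i - a) / 2, by simp; omega, by dsimp only; omega⟩

theorem coeff_one_add_pow_mul_inverseSeries (d t i : ℕ) :
    (coeff t ((1 + C Polynomial.X * X) ^ (d + 1) * inverseSeries (d + 1))).coeff i =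
      ∑ j ∈ Finset.range (i / 2 + 1), binom ((d + 1 : ℕ) : ℤ) (i - 2 * j) *
        binom (((d + 1 : ℕ) : ℤ) + t - 1 - i + j) d := by
  have h : (1 + C Polynomial.X * X : PowerSeries (Polynomial ℤ)) ^ (d + 1) =
      ∑ a ∈ Finset.range (d + 1 + 1), ((d + 1).choose a : PowerSeries (Polynomial ℤ)) *
        (C (Polynomial.X ^ a) * X ^ a) := by
    rw [add_comm, add_pow]
    refine Finset.sum_congr rfl fun a _ => ?_
    rw [one_pow, mul_one, mul_pow, map_pow]
    ring
  rw [h, Finset.sum_mul, map_sum, Polynomial.finsetSum_coeff]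
  simp only [mul_assoc ((d + 1).choose _ : PowerSeries (Polynomial ℤ)), coeff_natCast_mul_coeff, coeff_monomial_mul,
    coeff_inverseSeries]
  rw [sum_choose_mul_reindex _ i]
  · refine Finset.sum_congr rfl fun j hj => ?_
    have hj := Finset.mem_range.1 hj
    refine congrArg₂ (· * ·) ?_ ?_
    · rw [binom, if_pos (Int.natCast_nonneg _), Int.toNat_natCast]
    · unfold binom
      rw [show i - (i - 2 * j) = 2 * j by omega, show 2 * j / 2 = j by omega]
      -- Where the coefficient vanishes, the upper entry of `binom` is below `d`, possibly still
      -- nonnegative, so both sides are zero.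
      split_ifs with h1 h2 h3 h3 h3
      · rw [show ((((d + 1 : ℕ) : ℤ) + t - 1 - i + j)).toNat = d + (t - (i - 2 * j) - j) by omega]
      · omega
      · rw [Nat.choose_eq_zero_of_lt (by omega), Nat.cast_zero]
      · rfl
      · rw [Nat.choose_eq_zero_of_lt (by omega), Nat.cast_zero]
      · rfl
  · intro a ha
    split_ifs <;> omega

theorem coeff_pow_mul_inverseSeries (d t i b : ℕ) :
    (coeff t (C (1 + Polynomial.X) ^ (d + 1) * X ^ b * inverseSeries (d + 1))).coeff i =
      ∑ j ∈ Finset.range (i / 2 + 1), binom ((d + 1 : ℕ) : ℤ) (i - 2 * j) *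
        binom ((t : ℤ) - b + d - j) d := by
  have h : (C (1 + Polynomial.X) : PowerSeries (Polynomial ℤ)) ^ (d + 1) * X ^ b =
      ∑ a ∈ Finset.range (d + 1 + 1), ((d + 1).choose a : PowerSeries (Polynomial ℤ)) *
        (C (Polynomial.X ^ a) * X ^ b) := by
    rw [map_add, map_one, add_comm, add_pow, Finset.sum_mul]
    refine Finset.sum_congr rfl fun a _ => ?_
    rw [one_pow, mul_one, map_pow]
    ring
  rw [h, Finset.sum_mul, map_sum, Polynomial.finsetSum_coeff]
  simp only [mul_assoc ((d + 1).choose _ : PowerSeries (Polynomial ℤ)), coeff_natCast_mul_coeff, coeff_monomial_mul,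
    coeff_inverseSeries]
  rw [sum_choose_mul_reindex _ i]
  · refine Finset.sum_congr rfl fun j hj => ?_
    have hj := Finset.mem_range.1 hj
    refine congrArg₂ (· * ·) ?_ ?_
    · rw [binom, if_pos (Int.natCast_nonneg _), Int.toNat_natCast]
    · unfold binom
      rw [show i - (i - 2 * j) = 2 * j by omega, show 2 * j / 2 = j by omega]
      split_ifs with h1 h2 h3 h3 h3
      · rw [show ((t : ℤ) - b + d - j).toNat = d + (t - b - j) by omega]
      · omega
      · rw [Nat.choose_eq_zero_of_lt (by omega), Nat.cast_zero]
      · rfl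
      · rw [Nat.choose_eq_zero_of_lt (by omega), Nat.cast_zero]
      · rfl
  · intro a ha
    split_ifs <;> omega

/-- Putting `Z = 1 + z` turns `Z ^ r` into the generating polynomial of `r.choose i`, so the Betti
numbers are read off as coefficients. -/
theorem coeff_standardSeries (n t i : ℕ) :
    (coeff t (standardSeries n (1 + Polynomial.X : Polynomial ℤ))).coeff i =
      ((∑ w ∈ (Finset.univ : Finset (Fin n)).piAntidiag t with IsStandardWeight n (extendZero w),
        (Finset.univ.filter fun v : Fin n => IsColonVariable n (extendZero w) v).card.choose i :
          ℕ) : ℤ) := by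
  rw [standardSeries, coeff_mk, Polynomial.finsetSum_coeff, Nat.cast_sum]
  exact Finset.sum_congr rfl fun w _ => Polynomial.coeff_one_add_X_pow ℤ _ i

end Coefficients

/-! ### Assembly of the two formulas. -/

theorem theorem1p3 (K : Type*) [Field K] (k : ℕ) (hk : 1 ≤ k) (n t i : ℕ) :
    (n = 2 * k + 1 →
      Module.Finite K (torSpace (cyclePathIdeal K n (n - 2) ^ t) i) ∧
      (bettiNumber (cyclePathIdeal K n (n - 2) ^ t) i : ℤ) =
        ∑ j ∈ Finset.range (i / 2 + 1),
          binom n (i - 2 * j) * binom ((n : ℤ) + t - 1 - i + j) (n - 1)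
        - ∑ j ∈ Finset.range ((i + 1) / 2),
          binom n (i - 1 - 2 * j) * binom ((t : ℤ) + k - 1 - j) (n - 1)) ∧
    (n = 2 * k →
      Module.Finite K (torSpace (cyclePathIdeal K n (n - 2) ^ t) i) ∧
      (bettiNumber (cyclePathIdeal K n (n - 2) ^ t) i : ℤ) =
        ∑ j ∈ Finset.range (i / 2 + 1),
          binom n (i - 2 * j) * binom ((n : ℤ) + t - 1 - i + j) (n - 1)
        - ∑ j ∈ Finset.range (i / 2 + 1),
          binom n (i - 2 * j) * binom ((t : ℤ) + k - 1 - j) (n - 1)) := by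
  constructor
  · rintro rfl
    obtain ⟨p, hp⟩ := linearRes_cyclePathIdeal_pow K (n := 2 * k + 1) (by omega) t
    obtain ⟨h1, h2⟩ := hp.torSpace i
    refine ⟨h1, ?_⟩
    rw [h2, ← coeff_standardSeries,
      eq_mul_inverseSeries (standardSeries_odd (Polynomial.X : Polynomial ℤ) k), sub_mul, map_sub,
      Polynomial.coeff_sub, coeff_one_add_pow_mul_inverseSeries]
    congr 1
    rw [mul_assoc (PowerSeries.C Polynomial.X), mul_assoc (PowerSeries.C Polynomial.X),
      PowerSeries.coeff_C_mul]
    -- The extra factor `z` of the odd case shifts `i` to `i - 1`; for `i = 0` the subtracted sum is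
    -- empty.
    cases i with
    | zero => simp
    | succ i =>
      rw [Polynomial.coeff_X_mul, coeff_pow_mul_inverseSeries, show (i + 1 + 1) / 2 = i / 2 + 1 by omega]
      refine Finset.sum_congr rfl fun j _ => ?_
      rw [Nat.add_sub_cancel, Nat.add_sub_cancel]
      congr 2
      push_cast
      ring
  · rintro rfl
    obtain ⟨p, hp⟩ := linearRes_cyclePathIdeal_pow K (n := 2 * k) (by omega) t
    obtain ⟨h1, h2⟩ := hp.torSpace i
    refine ⟨h1, ?_⟩
    rw [h2, ← coeff_standardSeries,
      eq_mul_inverseSeries (standardSeries_even (Polynomial.X : Polynomial ℤ) k)]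
    obtain ⟨d, hd⟩ : ∃ d, 2 * k = d + 1 := ⟨2 * k - 1, by omega⟩
    rw [hd, sub_mul, map_sub, Polynomial.coeff_sub, coeff_one_add_pow_mul_inverseSeries,
      coeff_pow_mul_inverseSeries]
    congr 1
    refine Finset.sum_congr rfl fun j _ => ?_
    rw [Nat.add_sub_cancel]
    congr 2
    omega
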